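/- A \emph{domain} $\mathcal D$ is a disjoint union of finitely many circles $\mathbb R/l\mathbb Z$ ($l>0$) and semi-open bounded intervals $[\alpha,\beta)$ ($\alpha<\beta$), with its natural metric, orientation and topology. An \emph{interval exchange transformation} $\mathcal D\to\mathcal D'$ is a bijection that is piecewise isometric, orientation preserving, continuous on the right, and has finitely many discontinuity points; $\mathrm{IET}(\mathcal D,\mathcal D')$ is the set of these, and $\mathrm{IET}(\mathcal D)=\mathrm{IET}(\mathcal D,\mathcal D)$ is a group under composition. Elements $h\in\mathrm{IET}(\mathcal D)$ and $h'\in\mathrm{IET}(\mathcal D')$ are \emph{conjugate} if $h'=ghg^{-1}$ for some $g\in\mathrm{IET}(\mathcal D,\mathcal D')$. Let $d(h)$ be the number of discontinuity points of $h$, and let $\|h\|=\inf_{n\ge 1}\frac1n d(h^n)$ be its growth rate. A \emph{virtual multi-rotation} is a continuous element of some $\mathrm{IET}(\mathcal D)$. Let $\mathcal D$ be a domain and $h\in\mathrm{IET}(\mathcal D)$. Then $\|h\|=\lim_{n\to\infty}\frac1n d(h^n)$, and there exist a domain $\mathcal D_m$ and $h_m\in\mathrm{IET}(\mathcal D_m)$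 conjugate to $h$ such that $d(h_m^n)=n\,d(h_m)$ for all $n\in\mathbb N$. Moreover: \begin{enumerate} \item For every such $h_m$, $\|h\|=\|h_m\|=d(h_m)$. In particular, $\|h\|\in\mathbb N$. \item There is a constant $C$ such that $n\|h\|-C\le d(h^n)\le n\|h\|+C$ for all $n\ge 0$. \item For every such $h_m$ and every $h'\in\mathrm{IET}(\mathcal D')$ conjugate to $h$, on any domain $\mathcal D'$, $d(h_m^n)\le d(h'^n)$ for all $n\ge 0$. \item $\|h\|=0$ if and only if $h$ is conjugate to a virtual multi-rotation. \item If $h$ is divisible, i.e. for every $n\ge 1$ there is $g\in\mathrm{IET}(\mathcal D)$ with $g^n=h$, then $\|h\|=0$. More generally, $\|h\|=0$ as soon as $h$ has an $n$-th root in $\mathrm{IET}(\mathcal D)$ for arbitrarily large $n$. \end{enumerate} -/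

import Mathlib

namespace IET

open Filter Topology

/-- A component of a domain: a circle `ℝ / lℤ` of length `l > 0`, or a nonempty semi-open bounded
interval `[a, b)`. -/
inductive Component : Type
  | circle (l : ℝ) (hl : 0 < l) : Component
  | segment (a b : ℝ) (hab : a < b) : Component

/-- The set of points of a component. -/
def Component.Carrier : Component → Type
  | .circle l _ => AddCircle l
  | .segment a b _ => Set.Ico a b

/-- The usual topology: the quotient topology on `ℝ / lℤ`, the subspace topology on `[a, b)`. -/
instance Component.instTopologicalSpace (c : Component) : TopologicalSpace c.Carrier :=
  match c with
  | .circle l _ => inferInstanceAs (TopologicalSpace (AddCircle l))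
  | .segment a b _ => inferInstanceAs (TopologicalSpace (Set.Ico a b))

/-- The real number `r` is a coordinate of the point `x` (unique on an interval, unique
modulo `l` on a circle of length `l`). -/
def Component.HasCoord : (c : Component) → c.Carrier → ℝ → Prop
  | .circle l _, x, r => ((r : ℝ) : AddCircle l) = x
  | .segment _ _ _, x, r => x.1 = r

/-- A domain: a finite disjoint union of circles and semi-open bounded intervals. -/
structure Domain : Type where
  /-- the number of components -/
  n : ℕ
  /-- the components -/
  comp : Fin n → Component

/-- The points of a domain: the disjoint union of its components. -/
def Domain.Point (D : Domain) : Type := Σ i : Fin D.n, (D.comp i).Carrier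

/-- The disjoint union topology. -/
instance Domain.instTopologicalSpace (D : Domain) : TopologicalSpace D.Point :=
  inferInstanceAs (TopologicalSpace (Σ i : Fin D.n, (D.comp i).Carrier))

/-- On `[0, ℓ)`, the map `γ` is an injective, orientation preserving, unit speed parametrization
`t ↦ s + t` of a semi-open interval `[s, s + ℓ)` contained in one component of `D`. (On a circle of
length `l`, injectivity says that `ℓ ≤ l`.) -/
def Domain.IsArc (D : Domain) (γ : ℝ → D.Point) (ℓ : ℝ) : Prop :=
  0 < ℓ ∧ Set.InjOn γ (Set.Ico 0 ℓ) ∧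
    ∃ (i : Fin D.n) (s : ℝ), ∀ t ∈ Set.Ico 0 ℓ,
      ∃ x : (D.comp i).Carrier, (D.comp i).HasCoord x (s + t) ∧ γ t = ⟨i, x⟩

/-- A bijection `h : D → D'` is an interval exchange transformation if `D` can be partitioned into
finitely many semi-open intervals, closed on the left, on each of which `h` is an orientation
preserving isometry onto a semi-open interval of `D'` of the same length. Such a map is continuous
on the right, and it has finitely many discontinuity points
(`IsIET.finite_discontinuitySet` below). -/
def IsIET {D D' : Domain} (h : D.Point ≃ D'.Point) : Prop :=
  ∃ (k : ℕ) (γ : Fin k → ℝ → D.Point) (ℓ : Fin k → ℝ),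
    (∀ m, D.IsArc (γ m) (ℓ m)) ∧
    (∀ x, ∃! m, x ∈ γ m '' Set.Ico 0 (ℓ m)) ∧
    (∀ m, D'.IsArc (fun t => h (γ m t)) (ℓ m))

/-- The set `Δ(h)` of the points at which `h` is discontinuous. -/
def discontinuitySet {D D' : Domain} (h : D.Point ≃ D'.Point) : Set D.Point :=
  {x | ¬ ContinuousAt h x}

theorem Domain.IsArc.continuousOn {D : Domain} {γ : ℝ → D.Point} {ℓ : ℝ} (hγ : D.IsArc γ ℓ) :
    ContinuousOn γ (Set.Ico 0 ℓ) := by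
  obtain ⟨hℓ, -, i, s, h⟩ := hγ
  have hne : Nonempty (D.comp i).Carrier := ⟨(h 0 ⟨le_rfl, hℓ⟩).choose⟩
  choose! x hx hγx using h
  suffices hc : ContinuousOn x (Set.Ico 0 ℓ) by
    have h2 : ContinuousOn (fun t => (⟨i, x t⟩ : D.Point)) (Set.Ico 0 ℓ) :=
      (continuous_sigmaMk (σ := fun i => (D.comp i).Carrier)).comp_continuousOn hc
    exact h2.congr hγx
  clear hγx
  generalize D.comp i = c at x hx
  cases c with
  | circle l hl =>
    have h2 : ContinuousOn (fun t : ℝ => ((s + t : ℝ) : AddCircle l)) (Set.Ico 0 ℓ) :=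
      ((AddCircle.continuous_mk' l).comp (continuous_const.add continuous_id)).continuousOn
    exact h2.congr fun t ht => (hx t ht).symm
  | segment a b hab =>
    refine Topology.IsInducing.subtypeVal.continuousOn_iff.2 ?_
    have h2 : ContinuousOn (fun t : ℝ => s + t) (Set.Ico 0 ℓ) := by fun_prop
    exact h2.congr fun t ht => hx t ht

theorem Domain.IsArc.nhds_le {D : Domain} {γ : ℝ → D.Point} {ℓ : ℝ} (hγ : D.IsArc γ ℓ)
    {t : ℝ} (ht : t ∈ Set.Ioo 0 ℓ) : 𝓝 (γ t) ≤ Filter.map γ (𝓝 t) := by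
  obtain ⟨hℓ, -, i, s, h⟩ := hγ
  have hne : Nonempty (D.comp i).Carrier := ⟨(h 0 ⟨le_rfl, hℓ⟩).choose⟩
  choose! x hx hγx using h
  have hI : Set.Ioo 0 ℓ ∈ 𝓝 t := Ioo_mem_nhds ht.1 ht.2
  have hIco : ∀ u ∈ Set.Ioo 0 ℓ, u ∈ Set.Ico 0 ℓ := fun u hu => ⟨hu.1.le, hu.2⟩
  have e1 : Filter.map γ (𝓝 t) = Filter.map (fun u => (⟨i, x u⟩ : D.Point)) (𝓝 t) :=
    Filter.map_congr (Filter.mem_of_superset hI fun u hu => hγx u (hIco u hu))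
  have e2 : 𝓝 (⟨i, x t⟩ : D.Point) = Filter.map (fun y => (⟨i, y⟩ : D.Point)) (𝓝 (x t)) :=
    (Topology.IsOpenEmbedding.sigmaMk (σ := fun i => (D.comp i).Carrier)).map_nhds_eq _ |>.symm
  suffices hmain : 𝓝 (x t) ≤ Filter.map x (𝓝 t) from
    (le_of_eq ((congrArg 𝓝 (hγx t (hIco t ht))).trans e2)).trans <|
      (Filter.map_mono (m := fun y => (⟨i, y⟩ : D.Point)) hmain).trans <|
        le_of_eq (Filter.map_map.trans e1.symm)
  clear hγx e1 e2
  generalize D.comp i = c at x hx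
  intro A hA
  have hA' : {u | x u ∈ A} ∩ Set.Ioo 0 ℓ ∈ 𝓝 t := Filter.inter_mem hA hI
  obtain ⟨ε, hε, hball⟩ := Metric.mem_nhds_iff.1 hA'
  cases c with
  | circle l hl =>
    have hop : IsOpenMap (fun r : ℝ => (r : AddCircle l)) := QuotientAddGroup.isOpenMap_coe
    have h1 : (fun r : ℝ => (r : AddCircle l)) '' Metric.ball (s + t) ε
        ∈ 𝓝 (((s + t : ℝ)) : AddCircle l) :=
      hop.image_mem_nhds (Metric.ball_mem_nhds _ hε)
    have hxt : (((s + t : ℝ)) : AddCircle l) = x t := hx t (hIco t ht)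
    rw [hxt] at h1
    refine Filter.mem_of_superset h1 ?_
    rintro _ ⟨r, hr, rfl⟩
    have hr' : r - s ∈ Metric.ball t ε := by
      rw [Metric.mem_ball, Real.dist_eq] at hr ⊢
      rwa [show r - s - t = r - (s + t) by ring]
    have h2 := hball hr'
    have h3 : (((s + (r - s) : ℝ)) : AddCircle l) = x (r - s) := hx _ (hIco _ h2.2)
    rw [add_sub_cancel] at h3
    change (r : AddCircle l) ∈ A
    rw [h3]
    exact h2.1
  | segment a b hab =>
    have hxt : (x t).1 = s + t := hx t (hIco t ht)
    have h1 : {y : Set.Ico a b | y.1 ∈ Metric.ball (s + t) ε} ∈ 𝓝 (x t) := by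
      refine continuous_subtype_val.continuousAt.preimage_mem_nhds ?_
      rw [show (Subtype.val (x t) : ℝ) = s + t from hxt]
      exact Metric.ball_mem_nhds _ hε
    refine Filter.mem_of_superset h1 ?_
    intro y hy
    have hr' : y.1 - s ∈ Metric.ball t ε := by
      have hy' : y.1 ∈ Metric.ball (s + t) ε := hy
      rw [Metric.mem_ball, Real.dist_eq] at hy' ⊢
      rwa [show y.1 - s - t = y.1 - (s + t) by ring]
    have h2 := hball hr'
    have h3 : (x (y.1 - s)).1 = s + (y.1 - s) := hx _ (hIco _ h2.2)
    rw [add_sub_cancel] at h3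
    have h4 : x (y.1 - s) = y := Subtype.ext h3
    rw [← h4]
    exact h2.1

/-- An interval exchange transformation has finitely many discontinuity points. -/
theorem IsIET.finite_discontinuitySet {D D' : Domain} {h : D.Point ≃ D'.Point} (hh : IsIET h) :
    (discontinuitySet h).Finite := by
  obtain ⟨k, γ, ℓ, h1, h2, h3⟩ := hh
  refine (Set.finite_range fun m => γ m 0).subset ?_
  intro x hx
  obtain ⟨m, ⟨t, ht, rfl⟩, -⟩ := h2 x
  rcases ht.1.eq_or_lt with h0 | h0
  · exact ⟨m, by rw [← h0]⟩
  · exfalso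
    have hI : t ∈ Set.Ioo 0 (ℓ m) := ⟨h0, ht.2⟩
    have hc : ContinuousAt (fun t => h (γ m t)) t :=
      (h3 m).continuousOn.continuousAt (Ico_mem_nhds h0 ht.2)
    exact hx ((Filter.tendsto_map'_iff.2 hc).mono_left ((h1 m).nhds_le hI))

/-- The number `d(h)` of discontinuity points of `h`. -/
noncomputable def numDisc {D D' : Domain} (h : D.Point ≃ D'.Point) : ℕ :=
  (discontinuitySet h).ncard

/-- The growth rate `‖h‖ = inf { d(hⁿ) / n | n ≥ 1 }` of the number of discontinuity points. -/
noncomputable def growthRate {D : Domain} (h : Equiv.Perm D.Point) : ℝ :=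
  ⨅ n : ℕ+, (numDisc (h ^ (n : ℕ)) : ℝ) / (n : ℕ)

/-- `h` and `h'` are conjugate: `h' = g h g⁻¹` for an interval exchange transformation
`g : D → D'`. -/
def IsConjugate {D D' : Domain} (h : Equiv.Perm D.Point) (h' : Equiv.Perm D'.Point) : Prop :=
  ∃ g : D.Point ≃ D'.Point, IsIET g ∧ ∀ y, h' y = g (h (g.symm y))

/-- `hm` is an interval exchange transformation of the domain `Dm`, it is conjugate to `h`,
and `d(hmⁿ) = n d(hm)` for all `n`. -/
def IsMinimalModel {D Dm : Domain} (h : Equiv.Perm D.Point) (hm : Equiv.Perm Dm.Point) : Prop :=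
  IsIET hm ∧ IsConjugate h hm ∧ ∀ n : ℕ, numDisc (hm ^ n) = n * numDisc hm

/-- A virtual multi-rotation of `D` is a continuous interval exchange transformation of `D`. -/
def IsVirtualMultiRotation {D : Domain} (r : Equiv.Perm D.Point) : Prop :=
  IsIET r ∧ Continuous r

/-- `h` has a root of order `n` in the group of interval exchange transformations of `D`. -/
def HasRoot {D : Domain} (h : Equiv.Perm D.Point) (n : ℕ) : Prop :=
  ∃ g : Equiv.Perm D.Point, IsIET g ∧ g ^ n = h

/-- `h` is divisible: it has roots of every order `n ≥ 1`. -/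
def IsDivisible {D : Domain} (h : Equiv.Perm D.Point) : Prop :=
  ∀ n : ℕ, 1 ≤ n → HasRoot h n

end IET

/-! Counting discontinuities is subadditive under composition (`numDisc_trans_le`), so Fekete's
lemma turns the infimum into a limit and gives `n‖h‖ ≤ d(hⁿ)` with no error term. Since `(g h g⁻¹)ⁿ
= g hⁿ g⁻¹`, conjugation changes `d(hⁿ)` by an amount bounded independently of `n`
(`IsConjugate.exists_numDisc_le`), so the growth rate is a conjugacy invariant. Once a conjugate
`hm` with `d(hmⁿ) = n d(hm)` is known, everything else is formal: `‖h‖ = d(hm)` is an integer, it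
vanishes exactly when `hm` is continuous, and `‖gⁿ‖ = n‖g‖` with `‖g‖` an integer forbids roots of
large order unless `‖h‖ = 0`.

The substance is the minimal model, obtained by cutting and then gluing. An interval exchange is
always continuous at the left end of a segment, so cutting the domain at a point removes the
discontinuity there but may create one at its preimage. Cutting at all starting points of the
pieces, and at all orbit points between two of them, gives a conjugate that is `IsCoherent`
(`IsIET.exists_isCoherent`): each orbit meets the left ends in a run of consecutive points, and the
discontinuities are exactly the points just before a run is entered.

If some `hᵏ` is continuous at such a point `y`, then the left germ at `y` must be sent to the open
right end of a segment. That end can be glued to the left end `h y`, which preserves coherence and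
lowers the number of left ends (`IsCoherent.exists_glue`). In a coherent conjugate with fewest left
ends no discontinuity is ever repaired by iteration, and then `Δ(hⁿ)` is the disjoint union of the
`h⁻ⁱ Δ(h)` for `i < n` (`IsCoherent.numDisc_pow`). -/

namespace IET

open Filter Topology Set

/-! ### Coordinates and parametrizations of circles and segments -/

namespace Component

/-- The length of a component. -/
def len : Component → ℝ
  | .circle l _ => l
  | .segment a b _ => b - a

/-- The coordinate of the base point of a component. -/
def start : Component → ℝ
  | .circle _ _ => 0
  | .segment a _ _ => a

open Classical in
/-- The unit speed parametrization of a component, of interest on `[0, len)` (everywhere for a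
circle). -/
noncomputable def param : (c : Component) → ℝ → c.Carrier
  | .circle l _, t => (t : AddCircle l)
  | .segment a b hab, t =>
      if h : a + t ∈ Set.Ico a b then (⟨a + t, h⟩ : Set.Ico a b) else ⟨a, le_rfl, hab⟩

theorem param_segment {a b : ℝ} (hab : a < b) {t : ℝ} (h : a + t ∈ Set.Ico a b) :
    (segment a b hab).param t = (⟨a + t, h⟩ : Set.Ico a b) :=
  dif_pos h

/-- The component is a segment. -/
def IsSegment : Component → Prop
  | .circle _ _ => False
  | .segment _ _ _ => True

/-- The point is the left end of a segment. -/
def IsLeft : (c : Component) → c.Carrier → Prop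
  | .circle _ _, _ => False
  | .segment a _ _, x => x.1 = a

theorem len_pos (c : Component) : 0 < c.len := by
  cases c with
  | circle l hl => exact hl
  | segment a b hab => exact sub_pos.2 hab

theorem hasCoord_param (c : Component) {t : ℝ} (ht : t ∈ Ico 0 c.len) :
    c.HasCoord (c.param t) (c.start + t) := by
  cases c with
  | circle l hl => simp [HasCoord, start, param]
  | segment a b hab =>
    have h : a + t ∈ Ico a b := by
      obtain ⟨h1, h2⟩ := ht
      simp only [len] at h2
      constructor <;> linarith
    exact congrArg Subtype.val (param_segment hab h)

theorem hasCoord_param_of_not_isSegment (c : Component) (hc : ¬ c.IsSegment) (t : ℝ) :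
    c.HasCoord (c.param t) (c.start + t) := by
  cases c with
  | circle l hl => simp [HasCoord, start, param]
  | segment a b hab => exact (hc trivial).elim

theorem HasCoord.eq_of_add {c : Component} {x y y' : c.Carrier} {r r' u : ℝ}
    (h : c.HasCoord x r) (h' : c.HasCoord x r') (hy : c.HasCoord y (r + u))
    (hy' : c.HasCoord y' (r' + u)) : y = y' := by
  cases c with
  | circle l hl =>
    simp only [HasCoord] at *
    rw [← hy, ← hy', AddCircle.coe_add, AddCircle.coe_add, h, h']
  | segment a b hab =>
    simp only [HasCoord] at *
    apply Subtype.ext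
    rw [hy, hy', ← h, ← h']

theorem HasCoord.unique {c : Component} {y y' : c.Carrier} {r : ℝ}
    (hy : c.HasCoord y r) (hy' : c.HasCoord y' r) : y = y' := by
  have h1 : c.HasCoord y (r + 0) := by simpa using hy
  have h2 : c.HasCoord y' (r + 0) := by simpa using hy'
  exact hy.eq_of_add hy h1 h2

theorem exists_param (c : Component) (x : c.Carrier) : ∃ t ∈ Ico 0 c.len, c.param t = x := by
  cases c with
  | circle l hl =>
    have : Fact (0 < l) := ⟨hl⟩
    obtain ⟨t, ht, h⟩ := (AddCircle.eq_coe_Ico (p := l) x)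
    exact ⟨t, by simpa [len] using ht, h⟩
  | segment a b hab =>
    obtain ⟨r, hr⟩ := x
    refine ⟨r - a, ⟨sub_nonneg.2 hr.1, sub_lt_sub_right hr.2 a⟩, ?_⟩
    have h : a + (r - a) ∈ Ico a b := by simpa using hr
    exact (param_segment hab h).trans (Subtype.ext (by simp))

theorem injOn_hasCoord (c : Component) {x : ℝ → c.Carrier} {s r : ℝ} (hr : r ≤ c.len)
    (hx : ∀ t ∈ Ico 0 r, c.HasCoord (x t) (s + t)) : InjOn x (Ico 0 r) := by
  intro t ht t' ht' h
  have h1 := hx t ht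
  have h2 := hx t' ht'
  rw [h] at h1
  cases c with
  | circle l hl =>
    have : Fact (0 < l) := ⟨hl⟩
    simp only [HasCoord] at h1 h2
    have h3 := h1.trans h2.symm
    rw [AddCircle.coe_eq_coe_iff_of_mem_Ico (a := s)] at h3
    · linarith
    · simp only [len] at hr
      exact ⟨by linarith [ht.1], by linarith [ht.2]⟩
    · simp only [len] at hr
      exact ⟨by linarith [ht'.1], by linarith [ht'.2]⟩
  | segment a b hab =>
    simp only [HasCoord] at h1 h2
    linarith

theorem injOn_param (c : Component) : InjOn c.param (Ico 0 c.len) :=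
  c.injOn_hasCoord le_rfl fun _ ht => c.hasCoord_param ht

instance (c : Component) : T2Space c.Carrier :=
  match c with
  | .circle l _ => inferInstanceAs (T2Space (AddCircle l))
  | .segment a b _ => inferInstanceAs (T2Space (Set.Ico a b))

theorem HasCoord.tendsto {c : Component} {α : Type*} {F : Filter α} {x : α → c.Carrier}
    {f : α → ℝ} {p : c.Carrier} {r : ℝ} (hp : c.HasCoord p r)
    (hx : ∀ᶠ a in F, c.HasCoord (x a) (f a)) (hf : Tendsto f F (𝓝 r)) : Tendsto x F (𝓝 p) := by
  cases c with
  | circle l hl =>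
    have h1 : Tendsto (fun a => ((f a : ℝ) : AddCircle l)) F (𝓝 ((r : ℝ) : AddCircle l)) :=
      ((AddCircle.continuous_mk' l).tendsto r).comp hf
    simp only [HasCoord] at hp hx
    rw [hp] at h1
    exact h1.congr' hx
  | segment a b hab =>
    refine tendsto_subtype_rng.2 ?_
    simp only [HasCoord] at hp hx
    rw [hp]
    exact hf.congr' (hx.mono fun _ h => h.symm)

theorem HasCoord.of_tendsto {c : Component} {α : Type*} {F : Filter α} [F.NeBot]
    {x : α → c.Carrier} {f : α → ℝ} {p : c.Carrier} {r : ℝ}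
    (hx : ∀ᶠ a in F, c.HasCoord (x a) (f a)) (hf : Tendsto f F (𝓝 r)) (h : Tendsto x F (𝓝 p)) :
    c.HasCoord p r := by
  cases c with
  | circle l hl =>
    have h1 : Tendsto (fun a => ((f a : ℝ) : AddCircle l)) F (𝓝 ((r : ℝ) : AddCircle l)) :=
      ((AddCircle.continuous_mk' l).tendsto r).comp hf
    simp only [HasCoord] at hx ⊢
    exact tendsto_nhds_unique (h1.congr' hx) h
  | segment a b hab =>
    simp only [HasCoord] at hx ⊢
    have h1 : Tendsto (fun a => (x a).1) F (𝓝 p.1) := (tendsto_subtype_rng.1 h)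
    exact tendsto_nhds_unique h1 (hf.congr' (hx.mono fun _ h => h.symm))

/-- On a circle every real is a coordinate. In `[a, b)` the points `s + t` stay below `b`, so `s + e
≤ b`, and only equality prevents `s + e` from being a coordinate. -/
theorem exists_limit_or {c : Component} {x : ℝ → c.Carrier} {s e : ℝ} (he : 0 < e)
    (hx : ∀ t ∈ Ico 0 e, c.HasCoord (x t) (s + t)) :
    (∃ p, c.HasCoord p (s + e)) ∨ (c.IsSegment ∧ s + e = c.start + c.len) := by
  cases c with
  | circle l hl => exact Or.inl ⟨((s + e : ℝ) : AddCircle l), rfl⟩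
  | segment a b hab =>
    simp only [HasCoord] at hx
    have h1 : ∀ t ∈ Ico 0 e, s + t ∈ Ico a b := fun t ht => by
      rw [← hx t ht]
      exact (x t).2
    have h2 : a ≤ s := by simpa using (h1 0 ⟨le_rfl, he⟩).1
    have h3 : s + e ≤ b := by
      by_contra h
      push Not at h
      have hsb : s < b := by simpa using (h1 0 ⟨le_rfl, he⟩).2
      have := (h1 (b - s) ⟨by linarith, by linarith⟩).2
      linarith
    rcases h3.eq_or_lt with h | h
    · right
      exact ⟨trivial, by simp only [start, len]; linarith⟩
    · left
      exact ⟨⟨s + e, by linarith, h⟩, rfl⟩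

theorem HasCoord.not_isLeft {c : Component} {x y : c.Carrier} {s e : ℝ} (he : 0 < e)
    (hx : c.HasCoord x s) (hy : c.HasCoord y (s + e)) : ¬ c.IsLeft y := by
  cases c with
  | circle l hl => exact id
  | segment a b hab =>
    simp only [HasCoord, IsLeft] at *
    have := x.2.1
    rw [hy]
    intro h
    linarith

theorem isLeft_param_zero {c : Component} (hc : c.IsSegment) : c.IsLeft (c.param 0) := by
  have h := c.hasCoord_param ⟨le_rfl, c.len_pos⟩
  cases c with
  | circle l hl => exact hc.elim
  | segment a b hab =>
    simp only [HasCoord, start, add_zero] at h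
    exact h

theorem IsLeft.eq_param {c : Component} {x : c.Carrier} (hx : c.IsLeft x) :
    x = c.param 0 := by
  have h := c.hasCoord_param ⟨le_rfl, c.len_pos⟩
  cases c with
  | circle l hl => exact hx.elim
  | segment a b hab =>
    simp only [HasCoord, start, add_zero, IsLeft] at h hx
    exact Subtype.ext (hx.trans h.symm)

theorem IsLeft.isSegment {c : Component} {x : c.Carrier} (hx : c.IsLeft x) : c.IsSegment := by
  cases c with
  | circle l hl => exact hx.elim
  | segment a b hab => trivial

/-- Nothing lies to the left of `a` in `[a, b)`, so neighbourhoods of a left end are one-sided. -/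
theorem IsLeft.nhds_eq {c : Component} {x : c.Carrier} (hx : c.IsLeft x) :
    𝓝 x ≤ map c.param (𝓝[≥] 0) := by
  intro A hA
  cases c with
  | circle l hl => exact hx.elim
  | segment a b hab =>
    simp only [IsLeft] at hx
    have h0 : {t | (segment a b hab).param t ∈ A} ∈ 𝓝[≥] (0 : ℝ) := hA
    obtain ⟨e, he, hsub⟩ := (mem_nhdsGE_iff_exists_Ico_subset' (zero_lt_one (α := ℝ))).1 h0
    have h1 : {y : Set.Ico a b | y.1 ∈ Iio (a + e)} ∈ 𝓝 (x : Set.Ico a b) := by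
      refine continuous_subtype_val.continuousAt.preimage_mem_nhds ?_
      have hx' : (Subtype.val (x : Set.Ico a b)) = a := hx
      rw [hx']
      exact Iio_mem_nhds (by linarith [mem_Ioi.1 he])
    refine Filter.mem_of_superset h1 ?_
    intro y hy
    have hy1 := y.2.1
    have hy2 : y.1 < a + e := hy
    have := hsub (show y.1 - a ∈ Ico 0 e from ⟨by linarith, by linarith⟩)
    have h2 : a + (y.1 - a) ∈ Ico a b := by simpa using y.2
    have h3 : (segment a b hab).param (y.1 - a) = y :=
      (param_segment hab h2).trans (Subtype.ext (by simp))
    rw [← h3]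
    exact this

theorem exists_homeomorph {c c' : Component} (h : c = c') :
    ∃ f : c.Carrier ≃ₜ c'.Carrier, ∀ t, f (c.param t) = c'.param t := by
  subst h
  exact ⟨Homeomorph.refl _, fun _ => rfl⟩

end Component

end IET

/-! ### Arcs and left ends in a domain -/

namespace IET

open Filter Topology Set

theorem Component.HasCoord.shift {c : Component} {x y : c.Carrier} {r r' u : ℝ}
    (h : c.HasCoord x r) (h' : c.HasCoord x r') (hy : c.HasCoord y (r' + u)) :
    c.HasCoord y (r + u) := by
  cases c with
  | circle l hl =>
    simp only [HasCoord] at *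
    rw [← hy, AddCircle.coe_add, AddCircle.coe_add, h, h']
  | segment a b hab =>
    simp only [HasCoord] at *
    rw [hy, ← h, ← h']

namespace Domain

variable {D : Domain}

instance : T2Space D.Point :=
  inferInstanceAs (T2Space (Σ i : Fin D.n, (D.comp i).Carrier))

/-- The left ends of the segments of a domain. -/
def IsLeftEnd (x : D.Point) : Prop := (D.comp x.1).IsLeft x.2

theorem continuous_mk (i : Fin D.n) :
    Continuous (fun y : (D.comp i).Carrier => (⟨i, y⟩ : D.Point)) :=
  continuous_sigmaMk (σ := fun i => (D.comp i).Carrier)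

theorem isOpenEmbedding_mk (i : Fin D.n) :
    IsOpenEmbedding (fun y : (D.comp i).Carrier => (⟨i, y⟩ : D.Point)) :=
  Topology.IsOpenEmbedding.sigmaMk (σ := fun i => (D.comp i).Carrier)

theorem isArc_param (i : Fin D.n) {u r : ℝ} (hr : 0 < r) (hu : 0 ≤ u)
    (hur : u + r ≤ (D.comp i).len) : D.IsArc (fun t => ⟨i, (D.comp i).param (u + t)⟩) r := by
  have h : ∀ t ∈ Ico 0 r, (D.comp i).HasCoord ((D.comp i).param (u + t))
      ((D.comp i).start + u + t) := fun t ht => by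
    rw [add_assoc]
    exact (D.comp i).hasCoord_param ⟨by linarith [ht.1], by linarith [ht.2]⟩
  refine ⟨hr, ?_, i, (D.comp i).start + u, fun t ht => ⟨_, h t ht, rfl⟩⟩
  exact (isOpenEmbedding_mk i).injective.comp_injOn
    ((D.comp i).injOn_hasCoord (by linarith) h)

theorem isArc_param_of_not_isSegment (i : Fin D.n) (hi : ¬ (D.comp i).IsSegment) (u : ℝ) {r : ℝ}
    (hr : 0 < r) (hur : r ≤ (D.comp i).len) :
    D.IsArc (fun t => ⟨i, (D.comp i).param (u + t)⟩) r := by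
  have h : ∀ t ∈ Ico 0 r, (D.comp i).HasCoord ((D.comp i).param (u + t))
      ((D.comp i).start + u + t) := fun t _ => by
    rw [add_assoc]
    exact (D.comp i).hasCoord_param_of_not_isSegment hi _
  refine ⟨hr, ?_, i, (D.comp i).start + u, fun t ht => ⟨_, h t ht, rfl⟩⟩
  exact (isOpenEmbedding_mk i).injective.comp_injOn ((D.comp i).injOn_hasCoord hur h)

namespace IsArc

variable {γ γ' : ℝ → D.Point} {ℓ ℓ' : ℝ}

theorem congr (hγ : D.IsArc γ ℓ) (h : ∀ t ∈ Ico 0 ℓ, γ' t = γ t) : D.IsArc γ' ℓ := by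
  obtain ⟨h0, hinj, i, s, hx⟩ := hγ
  refine ⟨h0, hinj.congr fun t ht => (h t ht).symm, i, s, fun t ht => ?_⟩
  obtain ⟨x, h1, h2⟩ := hx t ht
  exact ⟨x, h1, (h t ht).trans h2⟩

/-- Both arcs run at unit speed, so a common point fixes the component and the coordinate (up to the
period), hence also the points at signed distance `u` from it. The displacement `u` may be negative.
-/
theorem agree (hγ : D.IsArc γ ℓ) (hγ' : D.IsArc γ' ℓ') {t t' u : ℝ} (ht : t ∈ Ico 0 ℓ)
    (ht' : t' ∈ Ico 0 ℓ') (htu : t + u ∈ Ico 0 ℓ) (htu' : t' + u ∈ Ico 0 ℓ')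
    (h : γ t = γ' t') : γ (t + u) = γ' (t' + u) := by
  obtain ⟨-, -, i, s, hx⟩ := hγ
  obtain ⟨-, -, i', s', hx'⟩ := hγ'
  obtain ⟨x, h1, h2⟩ := hx t ht
  obtain ⟨x', h1', h2'⟩ := hx' t' ht'
  obtain ⟨y, h3, h4⟩ := hx (t + u) htu
  obtain ⟨y', h3', h4'⟩ := hx' (t' + u) htu'
  rw [h2, h2'] at h
  obtain ⟨rfl, h⟩ := Sigma.mk.inj h
  obtain rfl := eq_of_heq h
  have hy : y = y' := h1.eq_of_add h1' (by rwa [← add_assoc] at h3) (by rwa [← add_assoc] at h3')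
  exact h4.trans ((congrArg (fun z => (⟨i, z⟩ : D.Point)) hy).trans h4'.symm)

theorem sub (hγ : D.IsArc γ ℓ) {u r : ℝ} (hu : 0 ≤ u) (hr : 0 < r) (hur : u + r ≤ ℓ) :
    D.IsArc (fun t => γ (u + t)) r := by
  obtain ⟨-, hinj, i, s, hx⟩ := hγ
  have hm : ∀ t ∈ Ico 0 r, u + t ∈ Ico 0 ℓ := fun t ht =>
    ⟨by linarith [ht.1], by linarith [ht.2]⟩
  refine ⟨hr, fun t ht t' ht' h => ?_, i, s + u, fun t ht => ?_⟩
  · linarith [hinj (hm t ht) (hm t' ht') h]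
  · rw [add_assoc]
    exact hx _ (hm t ht)

theorem not_isLeftEnd (hγ : D.IsArc γ ℓ) {t : ℝ} (ht : t ∈ Ioo 0 ℓ) : ¬ IsLeftEnd (γ t) := by
  obtain ⟨h0, -, i, s, hx⟩ := hγ
  obtain ⟨x, h1, h2⟩ := hx 0 ⟨le_rfl, h0⟩
  obtain ⟨y, h3, h4⟩ := hx t ⟨ht.1.le, ht.2⟩
  rw [h4]
  rw [add_zero] at h1
  exact h1.not_isLeft ht.1 h3

theorem eq_of_tendsto (hγ : D.IsArc γ ℓ) {i : Fin D.n} {s : ℝ}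
    (hx : ∀ t ∈ Ico 0 ℓ, ∃ x : (D.comp i).Carrier, (D.comp i).HasCoord x (s + t) ∧ γ t = ⟨i, x⟩)
    {p : D.Point} (hp : Tendsto γ (𝓝[<] ℓ) (𝓝 p)) :
    ∃ y : (D.comp i).Carrier, (D.comp i).HasCoord y (s + ℓ) ∧ p = ⟨i, y⟩ := by
  have hne : Nonempty (D.comp i).Carrier := ⟨(hx 0 ⟨le_rfl, hγ.1⟩).choose⟩
  choose! x hx hγx using hx
  have hev : ∀ᶠ t in 𝓝[<] ℓ, t ∈ Ico 0 ℓ := Ico_mem_nhdsLT hγ.1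
  obtain ⟨j, y⟩ := p
  have hj : ∀ᶠ t in 𝓝[<] ℓ, γ t ∈ range (fun y : (D.comp j).Carrier => (⟨j, y⟩ : D.Point)) :=
    hp.eventually ((isOpenEmbedding_mk j).isOpen_range.mem_nhds ⟨y, rfl⟩)
  obtain ⟨t, ht, z, hz⟩ := (hev.and hj).exists
  rw [hγx t ht] at hz
  obtain ⟨rfl, -⟩ := Sigma.mk.inj hz
  refine ⟨y, ?_, rfl⟩
  have h1 : Tendsto (fun t => (⟨j, x t⟩ : D.Point)) (𝓝[<] ℓ) (𝓝 ⟨j, y⟩) :=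
    hp.congr' (hev.mono fun t ht => hγx t ht)
  have h2 : Tendsto x (𝓝[<] ℓ) (𝓝 y) :=
    ((isOpenEmbedding_mk j).isInducing.tendsto_nhds_iff (f := x)).2 h1
  refine Component.HasCoord.of_tendsto (hev.mono fun t ht => hx t ht) ?_ h2
  exact ((continuous_const.add continuous_id).tendsto ℓ).mono_left nhdsWithin_le_nhds

/-- This is the dichotomy behind gluing: an arc either closes up at an honest point or runs off the
missing right end of a segment. -/
theorem exists_limit_or (hγ : D.IsArc γ ℓ) :
    (∃ p, ¬ IsLeftEnd p ∧ Tendsto γ (𝓝[<] ℓ) (𝓝 p)) ∨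
    ∃ i, (D.comp i).IsSegment ∧
      ∀ t ∈ Ico 0 ℓ, ∃ x : (D.comp i).Carrier,
        (D.comp i).HasCoord x ((D.comp i).start + (D.comp i).len - ℓ + t) ∧ γ t = ⟨i, x⟩ := by
  obtain ⟨h0, -, i, s, hx⟩ := hγ
  have hne : Nonempty (D.comp i).Carrier := ⟨(hx 0 ⟨le_rfl, h0⟩).choose⟩
  choose! x hx hγx using hx
  have hev : ∀ᶠ t in 𝓝[<] ℓ, t ∈ Ico 0 ℓ := Ico_mem_nhdsLT h0
  rcases Component.exists_limit_or h0 hx with ⟨p, hp⟩ | ⟨h1, h2⟩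
  · left
    refine ⟨⟨i, p⟩, (by simpa using hx 0 ⟨le_rfl, h0⟩ : Component.HasCoord _ _ _).not_isLeft h0 hp,
      ?_⟩
    have h3 : Tendsto x (𝓝[<] ℓ) (𝓝 p) := by
      refine hp.tendsto (hev.mono fun t ht => hx t ht) ?_
      exact ((continuous_const.add continuous_id).tendsto ℓ).mono_left nhdsWithin_le_nhds
    exact (((continuous_mk i).tendsto p).comp h3).congr' (hev.mono fun t ht => (hγx t ht).symm)
  · right
    refine ⟨i, h1, fun t ht => ⟨x t, ?_, hγx t ht⟩⟩
    rw [← h2, add_sub_cancel_right]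
    exact hx t ht

/-- The limit puts the two coordinates end to end in the same component. Injectivity has to be
assumed, because two arcs of a circle may overlap. -/
theorem concat (hγ : D.IsArc γ ℓ) (hγ' : D.IsArc γ' ℓ') (h : Tendsto γ (𝓝[<] ℓ) (𝓝 (γ' 0)))
    {f : ℝ → D.Point} (hf : ∀ t ∈ Ico 0 ℓ, f t = γ t) (hf' : ∀ t ∈ Ico 0 ℓ', f (ℓ + t) = γ' t)
    (hinj : InjOn f (Ico 0 (ℓ + ℓ'))) : D.IsArc f (ℓ + ℓ') := by
  have hγ0 := hγ
  obtain ⟨h0, -, i, s, hx⟩ := hγ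
  obtain ⟨h0', -, i', s', hx'⟩ := hγ'
  obtain ⟨y, hy, hp⟩ := hγ0.eq_of_tendsto hx h
  obtain ⟨y', hy', hp'⟩ := hx' 0 ⟨le_rfl, h0'⟩
  rw [hp] at hp'
  obtain ⟨rfl, hp'⟩ := Sigma.mk.inj hp'
  obtain rfl := eq_of_heq hp'
  refine ⟨by linarith, hinj, i, s, fun t ht => ?_⟩
  rcases lt_or_ge t ℓ with h1 | h1
  · rw [hf t ⟨ht.1, h1⟩]
    exact hx t ⟨ht.1, h1⟩
  · have ht' : t - ℓ ∈ Ico 0 ℓ' := ⟨by linarith, by linarith [ht.2]⟩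
    obtain ⟨z, hz, hz'⟩ := hx' _ ht'
    refine ⟨z, ?_, ?_⟩
    · rw [add_zero] at hy'
      have := hy.shift hy' hz
      rwa [show s + ℓ + (t - ℓ) = s + t by ring] at this
    · rw [← hz', ← hf' _ ht', add_sub_cancel]

theorem tendsto_nhdsGE (hγ : D.IsArc γ ℓ) {t : ℝ} (ht : t ∈ Ico 0 ℓ) :
    Tendsto γ (𝓝[≥] t) (𝓝 (γ t)) := by
  refine (hγ.continuousOn t ht).mono_left ?_
  rw [nhdsWithin_le_iff]
  exact mem_of_superset (Ico_mem_nhdsGE ht.2) fun u hu => ⟨ht.1.trans hu.1, hu.2⟩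

theorem tendsto_nhds (hγ : D.IsArc γ ℓ) {t : ℝ} (ht : t ∈ Ioo 0 ℓ) :
    Tendsto γ (𝓝 t) (𝓝 (γ t)) :=
  hγ.continuousOn.continuousAt (Ico_mem_nhds ht.1 ht.2)

theorem nhds_le_of_isLeftEnd (hγ : D.IsArc γ ℓ) (h : IsLeftEnd (γ 0)) :
    𝓝 (γ 0) ≤ map γ (𝓝[≥] 0) := by
  have h0 := hγ.1
  generalize hy : γ 0 = y at h
  obtain ⟨i, x⟩ := y
  have hx : (D.comp i).IsLeft x := h
  have hmin : 0 < min ℓ (D.comp i).len := lt_min h0 (D.comp i).len_pos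
  have harc : D.IsArc (fun t => ⟨i, (D.comp i).param (0 + t)⟩) (D.comp i).len :=
    isArc_param i (D.comp i).len_pos le_rfl (by simp)
  have hag : ∀ t ∈ Ico 0 (min ℓ (D.comp i).len), γ t = ⟨i, (D.comp i).param t⟩ := by
    intro t ht
    have := hγ.agree harc (t := 0) (t' := 0) (u := t) ⟨le_rfl, h0⟩
      ⟨le_rfl, (D.comp i).len_pos⟩ (by simpa using ⟨ht.1, ht.2.trans_le (min_le_left _ _)⟩)
      (by simpa using ⟨ht.1, ht.2.trans_le (min_le_right _ _)⟩)
      (by rw [hy, hx.eq_param, add_zero])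
    simpa using this
  have e1 : map γ (𝓝[≥] 0) = map (fun t => (⟨i, (D.comp i).param t⟩ : D.Point)) (𝓝[≥] 0) :=
    map_congr (mem_of_superset (Ico_mem_nhdsGE hmin) hag)
  have e2 : 𝓝 (⟨i, x⟩ : D.Point) = map (fun y => (⟨i, y⟩ : D.Point)) (𝓝 x) :=
    ((isOpenEmbedding_mk i).map_nhds_eq x).symm
  rw [e1]
  exact (le_of_eq e2).trans ((map_mono hx.nhds_eq).trans (le_of_eq map_map))

end IsArc

theorem exists_isArc_of_not_isLeftEnd {x : D.Point} (hx : ¬ IsLeftEnd x) :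
    ∃ (γ : ℝ → D.Point) (ℓ t : ℝ), D.IsArc γ ℓ ∧ t ∈ Ioo 0 ℓ ∧ γ t = x := by
  obtain ⟨i, y⟩ := x
  obtain ⟨t, ht, rfl⟩ := (D.comp i).exists_param y
  have hl := (D.comp i).len_pos
  by_cases hi : (D.comp i).IsSegment
  · refine ⟨_, _, t, isArc_param i hl le_rfl (by simp), ⟨ht.1.lt_of_ne ?_, ht.2⟩,
      by rw [zero_add]⟩
    rintro rfl
    exact hx (Component.isLeft_param_zero hi)
  -- On a circle, start half a turn before the point, so that it becomes interior even when it is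
  -- the base point.
  · refine ⟨_, _, (D.comp i).len / 2, isArc_param_of_not_isSegment i hi
      (t - (D.comp i).len / 2) hl le_rfl, ⟨by linarith, by linarith⟩,
      by rw [sub_add_cancel]⟩

theorem exists_isArc (x : D.Point) : ∃ (γ : ℝ → D.Point) (ℓ : ℝ), D.IsArc γ ℓ ∧ γ 0 = x := by
  obtain ⟨i, y⟩ := x
  obtain ⟨t, ht, rfl⟩ := (D.comp i).exists_param y
  exact ⟨_, (D.comp i).len - t, isArc_param i (u := t) (by linarith [ht.2]) ht.1 (by simp),
    by rw [add_zero]⟩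

theorem finite_setOf_isLeftEnd : {x : D.Point | IsLeftEnd x}.Finite := by
  refine (finite_range fun i : Fin D.n => (⟨i, (D.comp i).param 0⟩ : D.Point)).subset ?_
  rintro ⟨i, x⟩ hx
  exact ⟨i, by rw [(show (D.comp i).IsLeft x from hx).eq_param]⟩

end Domain

end IET

/-! ### Partitions of a domain into arcs -/

namespace IET

open Filter Topology Set

/-- The arcs `γ m` on `[0, ℓ m)` form a partition of the domain. -/
def Domain.IsPartition (D : Domain) {ι : Type*} (γ : ι → ℝ → D.Point) (ℓ : ι → ℝ) : Prop :=
  (∀ m, D.IsArc (γ m) (ℓ m)) ∧ ∀ x, ∃! m, x ∈ γ m '' Ico 0 (ℓ m)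

namespace Domain.IsPartition

variable {D D' : Domain} {ι : Type*} {γ : ι → ℝ → D.Point} {ℓ : ι → ℝ}

theorem eq_of_eq (hp : D.IsPartition γ ℓ) {m m' : ι} {t t' : ℝ} (ht : t ∈ Ico 0 (ℓ m))
    (ht' : t' ∈ Ico 0 (ℓ m')) (h : γ m t = γ m' t') : m = m' ∧ t = t' := by
  obtain ⟨j, -, hj⟩ := hp.2 (γ m t)
  obtain rfl : m = m' := (hj m ⟨t, ht, rfl⟩).trans (hj m' ⟨t', ht', h.symm⟩).symm
  exact ⟨rfl, (hp.1 m).2.1 ht ht' h⟩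

theorem exists_eq (hp : D.IsPartition γ ℓ) (x : D.Point) : ∃ m, ∃ t ∈ Ico 0 (ℓ m), γ m t = x :=
  (hp.2 x).exists

theorem map (hp : D.IsPartition γ ℓ) (h : D.Point ≃ D'.Point)
    (hh : ∀ m, D'.IsArc (fun t => h (γ m t)) (ℓ m)) :
    D'.IsPartition (fun m t => h (γ m t)) ℓ := by
  refine ⟨hh, fun x => ?_⟩
  obtain ⟨m, ⟨t, ht, htx⟩, hm⟩ := hp.2 (h.symm x)
  refine ⟨m, ⟨t, ht, by simp [htx]⟩, ?_⟩
  rintro m' ⟨t', ht', rfl⟩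
  exact hm m' ⟨t', ht', by simp⟩

theorem reindex (hp : D.IsPartition γ ℓ) {κ : Type*} (e : κ ≃ ι) :
    D.IsPartition (fun m => γ (e m)) (fun m => ℓ (e m)) := by
  refine ⟨fun m => hp.1 _, fun x => ?_⟩
  obtain ⟨m, hm, hu⟩ := hp.2 x
  refine ⟨e.symm m, by simpa using hm, fun j hj => ?_⟩
  rw [← hu _ hj, e.symm_apply_apply]

/-- An arc that avoids the starting points of the pieces of a partition is contained in one of
the pieces. -/
theorem exists_subarc (hp : D.IsPartition γ ℓ) {δ : ℝ → D.Point} {r : ℝ} (hδ : D.IsArc δ r)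
    (h : ∀ t ∈ Ioo 0 r, ∀ j, δ t ≠ γ j 0) :
    ∃ j w, 0 ≤ w ∧ w + r ≤ ℓ j ∧ ∀ t ∈ Ico 0 r, δ t = γ j (w + t) := by
  have hr := hδ.1
  obtain ⟨j, w, hw, hjw⟩ := hp.exists_eq (δ 0)
  have hag : ∀ t ∈ Ico 0 r, w + t < ℓ j → δ t = γ j (w + t) := by
    intro t ht hlt
    have := hδ.agree (hp.1 j) (t := 0) (t' := w) (u := t) ⟨le_rfl, hr⟩ hw (by simpa using ht)
      ⟨by linarith [ht.1, hw.1], hlt⟩ hjw.symm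
    simpa using this
  -- If `δ` left piece `j` early, its exit point would be interior to some piece `j'`. Stepping back
  -- by a small `e` lands in both pieces, so `j' = j`, and the exit point would have parameter `ℓ
  -- j`, which is excluded from the piece.
  have hle : w + r ≤ ℓ j := by
    by_contra hlt
    push Not at hlt
    have ht1 : ℓ j - w ∈ Ioo 0 r := ⟨by linarith [hw.2], by linarith⟩
    obtain ⟨j', w', hw', hjw'⟩ := hp.exists_eq (δ (ℓ j - w))
    have hw0 : 0 < w' := by
      refine hw'.1.lt_of_ne ?_
      rintro rfl
      exact h _ ht1 j' hjw'.symm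
    have hm : 0 < min w' (ℓ j - w) := lt_min hw0 ht1.1
    have hm1 := min_le_left w' (ℓ j - w)
    have hm2 := min_le_right w' (ℓ j - w)
    set e := min w' (ℓ j - w) / 2 with he
    have h1 := hδ.agree (hp.1 j') (t := ℓ j - w) (t' := w') (u := -e) ⟨ht1.1.le, ht1.2⟩ hw'
      ⟨by linarith, by linarith [ht1.2]⟩ ⟨by linarith, by linarith [hw'.2]⟩ hjw'.symm
    rw [hag _ ⟨by linarith, by linarith [ht1.2]⟩ (by linarith)] at h1
    obtain ⟨rfl, h2⟩ := hp.eq_of_eq ⟨by linarith [hw.1], by linarith⟩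
      ⟨by linarith, by linarith [hw'.2]⟩ h1
    linarith [hw'.2]
  exact ⟨j, w, hw.1, hle, fun t ht => hag t ht (by linarith [ht.2])⟩

/-- A partition can be refined so that its starting points are any given finite set that contains
the starting points of the original pieces. -/
theorem exists_refinement (hp : D.IsPartition γ ℓ) {G : Set D.Point} (hG : G.Finite)
    (hsub : ∀ m, γ m 0 ∈ G) :
    ∃ (k : ℕ) (m : Fin k → ι) (u r : Fin k → ℝ),
      D.IsPartition (fun j t => γ (m j) (u j + t)) r ∧
      (∀ j, 0 ≤ u j ∧ u j + r j ≤ ℓ (m j)) ∧ ∀ x, x ∈ G ↔ ∃ j, γ (m j) (u j) = x := by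
  have hfin : ∀ m, {t | t ∈ Ico 0 (ℓ m) ∧ γ m t ∈ G}.Finite := fun m =>
    Set.Finite.of_finite_image (f := γ m) (hG.subset (by rintro _ ⟨t, ht, rfl⟩; exact ht.2))
      fun t ht t' ht' h => (hp.1 m).2.1 ht.1 ht'.1 h
  -- The refined piece starting at `x` stops at the next point of `G` in the same piece, or at the
  -- end of that piece.
  have hnext : ∀ x : G, ∃ (m : ι) (u v : ℝ), u ∈ Ico 0 (ℓ m) ∧ γ m u = x ∧ u < v ∧ v ≤ ℓ m ∧
      (∀ t ∈ Ioo u v, γ m t ∉ G) ∧ (v = ℓ m ∨ γ m v ∈ G) := by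
    intro x
    obtain ⟨m, u, hu, hx⟩ := hp.exists_eq x
    have hS : (insert (ℓ m) {t | t ∈ Ico 0 (ℓ m) ∧ γ m t ∈ G} ∩ Ioi u).Finite :=
      ((hfin m).insert _).inter_of_left _
    obtain ⟨v, ⟨hv1, hv2⟩, hv⟩ := Set.exists_min_image _ id hS ⟨ℓ m, Or.inl rfl, hu.2⟩
    have hvl : v ≤ ℓ m := by
      rcases hv1 with rfl | h
      · exact le_rfl
      · exact h.1.2.le
    refine ⟨m, u, v, hu, hx, hv2, hvl, fun t ht htG => ?_, ?_⟩
    · have := hv t ⟨Or.inr ⟨⟨hu.1.trans ht.1.le, ht.2.trans_le hvl⟩, htG⟩, ht.1⟩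
      exact absurd ht.2 (not_lt.2 this)
    · rcases hv1 with h | h
      · exact Or.inl h
      · exact Or.inr h.2
  choose m u v hu hx huv hvl hno hend using hnext
  have : Finite G := hG
  obtain ⟨k, ⟨e⟩⟩ := Finite.exists_equiv_fin G
  suffices hP : D.IsPartition (fun (x : G) t => γ (m x) (u x + t)) (fun x => v x - u x) by
    refine ⟨k, fun j => m (e.symm j), fun j => u (e.symm j), fun j => v (e.symm j) - u (e.symm j),
      hP.reindex e.symm, fun j => ⟨(hu _).1, by simpa using hvl _⟩, fun x => ⟨fun h => ?_, ?_⟩⟩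
    · exact ⟨e ⟨x, h⟩, by simp only [Equiv.symm_apply_apply]; exact hx _⟩
    · rintro ⟨j, rfl⟩
      rw [hx]
      exact (e.symm j).2
  refine ⟨fun x => (hp.1 _).sub (hu x).1 (sub_pos.2 (huv x)) (by simpa using hvl x), fun y => ?_⟩
  obtain ⟨j, t, ht, rfl⟩ := hp.exists_eq y
  have hS : ({p | p ∈ Ico 0 (ℓ j) ∧ γ j p ∈ G} ∩ Iic t).Finite := (hfin j).inter_of_left _
  -- The refined piece containing a point starts at the last cut `p` not after it; one exists
  -- because the piece's own start is in `G`.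
  obtain ⟨p, ⟨⟨hp1, hp2⟩, hp3⟩, hmax⟩ := Set.exists_max_image _ id hS
    ⟨0, ⟨⟨le_rfl, ht.1.trans_lt ht.2⟩, hsub j⟩, ht.1⟩
  obtain ⟨hmj, hup⟩ := hp.eq_of_eq (hu ⟨γ j p, hp2⟩) hp1 (hx ⟨γ j p, hp2⟩)
  refine ⟨⟨γ j p, hp2⟩, ⟨t - p, ⟨sub_nonneg.2 hp3, ?_⟩, ?_⟩, ?_⟩
  · beta_reduce
    rw [hup]
    refine sub_lt_sub_right ?_ p
    by_contra hlt
    push Not at hlt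
    rcases hend ⟨γ j p, hp2⟩ with h | h
    · rw [h, hmj] at hlt
      exact absurd ht.2 (not_lt.2 hlt)
    · rw [hmj] at h
      have h1 := huv ⟨γ j p, hp2⟩
      rw [hup] at h1
      have h2 := hmax (v ⟨γ j p, hp2⟩) ⟨⟨⟨hp1.1.trans h1.le, hlt.trans_lt ht.2⟩, h⟩, hlt⟩
      exact absurd h1 (not_lt.2 h2)
  · simp only [hup, hmj, add_sub_cancel]
  · rintro y ⟨s, hs, hys⟩
    simp only at hys
    obtain ⟨h1, h2⟩ := hp.eq_of_eq ⟨by linarith [(hu y).1, hs.1], by linarith [hs.2, hvl y]⟩ ht hys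
    have hy := hx y
    rw [h1] at hy
    have hyG : γ j (u y) ∈ G := hy ▸ y.2
    have hle : u y ≤ p :=
      hmax (u y) ⟨⟨h1 ▸ hu y, hyG⟩, show u y ≤ t by linarith [hs.1]⟩
    rcases hle.eq_or_lt with h | h
    · apply Subtype.ext
      rw [← hy, h]
    · exfalso
      refine hno y p ⟨h, ?_⟩ (by rwa [h1])
      linarith [hs.2, mem_Iic.1 hp3]

end Domain.IsPartition

theorem Domain.isPartition_param (D : Domain) :
    D.IsPartition (fun i t => (⟨i, (D.comp i).param t⟩ : D.Point)) fun i => (D.comp i).len := by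
  refine ⟨fun i => ?_, ?_⟩
  · simpa only [zero_add] using
      Domain.isArc_param (D := D) i (u := 0) (D.comp i).len_pos le_rfl (by simp)
  · rintro ⟨i, x⟩
    obtain ⟨t, ht, rfl⟩ := (D.comp i).exists_param x
    refine ⟨i, ⟨t, ht, rfl⟩, ?_⟩
    rintro j ⟨s, -, hs⟩
    exact (Sigma.mk.inj hs).1

/-! ### Composition, inverses and one-sided continuity of interval exchanges -/

variable {D D' D'' : Domain} {h : D.Point ≃ D'.Point}

theorem isIET_iff : IsIET h ↔ ∃ (k : ℕ) (γ : Fin k → ℝ → D.Point) (ℓ : Fin k → ℝ),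
    D.IsPartition γ ℓ ∧ ∀ m, D'.IsArc (fun t => h (γ m t)) (ℓ m) := by
  simp only [IsIET, Domain.IsPartition, and_assoc]

namespace IsIET

theorem of_partition {ι : Type*} [Finite ι] {γ : ι → ℝ → D.Point} {ℓ : ι → ℝ}
    (hp : D.IsPartition γ ℓ) (hh : ∀ m, D'.IsArc (fun t => h (γ m t)) (ℓ m)) : IsIET h := by
  obtain ⟨k, ⟨e⟩⟩ := Finite.exists_equiv_fin ι
  exact isIET_iff.2 ⟨k, _, _, hp.reindex e.symm, fun m => hh _⟩

theorem symm (hh : IsIET h) : IsIET h.symm := by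
  obtain ⟨k, γ, ℓ, hp, hγ⟩ := isIET_iff.1 hh
  exact of_partition (hp.map h hγ) fun m => by simpa using hp.1 m

theorem trans {f : D'.Point ≃ D''.Point} (hh : IsIET h) (hf : IsIET f) :
    IsIET (h.trans f) := by
  obtain ⟨k, γ, ℓ, hp, hγ⟩ := isIET_iff.1 hh
  obtain ⟨k', γ', ℓ', hp', hγ'⟩ := isIET_iff.1 hf
  -- Cut also at the preimages of the starting points for `f`, so that `h` maps each refined piece
  -- into a single piece for `f`.
  have hfin : (range (fun m => γ m 0) ∪ range (fun m => h.symm (γ' m 0))).Finite :=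
    (finite_range _).union (finite_range _)
  obtain ⟨n, m, u, r, hP, hur, hst⟩ :=
    hp.exists_refinement hfin fun m => Or.inl ⟨m, rfl⟩
  refine of_partition hP fun j => ?_
  have h1 : D'.IsArc (fun t => h (γ (m j) (u j + t))) (r j) :=
    (hγ (m j)).sub (hur j).1 (hP.1 j).1 (hur j).2
  obtain ⟨i, w, hw, hwr, hi⟩ := hp'.exists_subarc h1 (by
    intro t ht i hti
    obtain ⟨j', hj'⟩ := (hst (γ (m j) (u j + t))).1 (Or.inr ⟨i, by simp [← hti]⟩)
    have := hP.eq_of_eq (m := j') (m' := j) (t := 0) (t' := t) ⟨le_rfl, (hP.1 j').1⟩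
      ⟨ht.1.le, ht.2⟩ (by simpa using hj')
    exact ht.1.ne this.2)
  refine ((hγ' i).sub hw h1.1 hwr).congr fun t ht => ?_
  exact congrArg f (hi t ht)

theorem refl : IsIET (Equiv.refl D.Point) :=
  of_partition D.isPartition_param D.isPartition_param.1

theorem pow {h : Equiv.Perm D.Point} (hh : IsIET h) (n : ℕ) : IsIET (h ^ n) := by
  induction n with
  | zero => exact refl
  | succ n ih =>
    rw [pow_succ]
    exact hh.trans ih

theorem exists_right_arc (hh : IsIET h) {γ : ℝ → D.Point} {ℓ t : ℝ} (hγ : D.IsArc γ ℓ)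
    (ht : t ∈ Ico 0 ℓ) : ∃ r, t + r ≤ ℓ ∧ D'.IsArc (fun u => h (γ (t + u))) r := by
  obtain ⟨k, γ', ℓ', hp, hγ'⟩ := isIET_iff.1 hh
  obtain ⟨j, w, hw, hjw⟩ := hp.exists_eq (γ t)
  have hr : 0 < min (ℓ - t) (ℓ' j - w) := lt_min (sub_pos.2 ht.2) (sub_pos.2 hw.2)
  have h1 := min_le_left (ℓ - t) (ℓ' j - w)
  have h2 := min_le_right (ℓ - t) (ℓ' j - w)
  refine ⟨min (ℓ - t) (ℓ' j - w), by linarith, ?_⟩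
  refine ((hγ' j).sub hw.1 hr (by linarith)).congr fun u hu => congrArg h ?_
  exact hγ.agree (hp.1 j) ht hw ⟨by linarith [ht.1, hu.1], by linarith [hu.2]⟩
    ⟨by linarith [hw.1, hu.1], by linarith [hu.2]⟩ hjw.symm

theorem exists_left_arc (hh : IsIET h) {γ : ℝ → D.Point} {ℓ t : ℝ} (hγ : D.IsArc γ ℓ)
    (ht : t ∈ Ioc 0 ℓ) :
    ∃ e ∈ Ico 0 t, D'.IsArc (fun u => h (γ (e + u))) (t - e) := by
  obtain ⟨k, γ', ℓ', hp, hγ'⟩ := isIET_iff.1 hh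
  have hfin : {u | u ∈ Ico 0 t ∧ γ u ∈ range fun j => γ' j 0}.Finite :=
    Set.Finite.of_finite_image (f := γ)
      ((finite_range fun j => γ' j 0).subset (by rintro _ ⟨u, hu, rfl⟩; exact hu.2))
      fun u hu u' hu' h => hγ.2.1 ⟨hu.1.1, hu.1.2.trans_le ht.2⟩ ⟨hu'.1.1, hu'.1.2.trans_le ht.2⟩ h
  -- `e` is the last time before `t` at which `γ` meets the start of a piece, or `0` if there is
  -- none.
  obtain ⟨e, he, hmax⟩ := Set.exists_max_image _ id (hfin.insert 0) ⟨0, Or.inl rfl⟩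
  have he0 : e ∈ Ico 0 t := by
    rcases he with rfl | h
    · exact ⟨le_rfl, ht.1⟩
    · exact h.1
  refine ⟨e, he0, ?_⟩
  have hs : D.IsArc (fun u => γ (e + u)) (t - e) :=
    hγ.sub he0.1 (sub_pos.2 he0.2) (by linarith [ht.2])
  obtain ⟨j, w, hw, hwr, hj⟩ := hp.exists_subarc hs (by
    intro u hu j hju
    have : e + u ≤ e := hmax _ (Or.inr ⟨⟨by linarith [he0.1, hu.1], by linarith [hu.2]⟩, j,
      hju.symm⟩)
    linarith [hu.1])
  exact ((hγ' j).sub hw hs.1 hwr).congr fun u hu => congrArg h (hj u hu)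

theorem tendsto_nhdsGE (hh : IsIET h) {γ : ℝ → D.Point} {ℓ t : ℝ} (hγ : D.IsArc γ ℓ)
    (ht : t ∈ Ico 0 ℓ) : Tendsto (fun u => h (γ u)) (𝓝[≥] t) (𝓝 (h (γ t))) := by
  obtain ⟨r, -, harc⟩ := hh.exists_right_arc hγ ht
  have h1 := harc.tendsto_nhdsGE ⟨le_rfl, harc.1⟩
  have h2 : Tendsto (fun u => u - t) (𝓝[≥] t) (𝓝[≥] 0) := by
    refine tendsto_nhdsWithin_iff.2 ⟨?_, eventually_mem_nhdsWithin.mono fun u hu => ?_⟩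
    · have : Tendsto (fun u => u - t) (𝓝 t) (𝓝 (t - t)) := tendsto_id.sub_const t
      rw [sub_self] at this
      exact this.mono_left nhdsWithin_le_nhds
    · exact sub_nonneg.2 (mem_Ici.1 hu)
  have h3 := h1.comp h2
  simpa [Function.comp_def] using h3

/-- Interval exchanges are continuous on the right, and a left end only has a right side. -/
theorem continuousAt_of_isLeftEnd (hh : IsIET h) {x : D.Point} (hx : Domain.IsLeftEnd x) :
    ContinuousAt h x := by
  obtain ⟨γ, ℓ, hγ, rfl⟩ := Domain.exists_isArc x
  exact (tendsto_map'_iff.2 (hh.tendsto_nhdsGE hγ ⟨le_rfl, hγ.1⟩)).mono_left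
    (hγ.nhds_le_of_isLeftEnd hx)

theorem continuousAt_of_tendsto_left (hh : IsIET h) {γ : ℝ → D.Point} {ℓ t : ℝ}
    (hγ : D.IsArc γ ℓ) (ht : t ∈ Ioo 0 ℓ)
    (hl : Tendsto (fun u => h (γ u)) (𝓝[<] t) (𝓝 (h (γ t)))) : ContinuousAt h (γ t) := by
  refine (tendsto_map'_iff.2 ?_).mono_left (hγ.nhds_le ht)
  have := hl.sup (hh.tendsto_nhdsGE hγ ⟨ht.1.le, ht.2⟩)
  rwa [← nhdsLT_sup_nhdsGE]

/-- Where it is continuous, away from left ends, an interval exchange transformation is a local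
homeomorphism. -/
theorem not_isLeftEnd_and_continuousAt_symm (hh : IsIET h) {x : D.Point}
    (hx : ¬ Domain.IsLeftEnd x) (hc : ContinuousAt h x) :
    ¬ Domain.IsLeftEnd (h x) ∧ ContinuousAt h.symm (h x) := by
  obtain ⟨γ, ℓ, t, hγ, ht, rfl⟩ := Domain.exists_isArc_of_not_isLeftEnd hx
  obtain ⟨e, he, h1⟩ := hh.exists_left_arc hγ (t := t) ⟨ht.1, ht.2.le⟩
  obtain ⟨r, hr, h2⟩ := hh.exists_right_arc hγ (t := t) ⟨ht.1.le, ht.2⟩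
  have hlim : Tendsto (fun u => h (γ (e + u))) (𝓝[<] (t - e)) (𝓝 (h (γ (t + 0)))) := by
    rw [add_zero]
    have h3 : Tendsto (fun u => e + u) (𝓝 (t - e)) (𝓝 (e + (t - e))) :=
      tendsto_const_nhds.add tendsto_id
    rw [add_sub_cancel] at h3
    exact hc.tendsto.comp ((hγ.tendsto_nhds ht).comp (h3.mono_left nhdsWithin_le_nhds))
  -- Continuity joins the images of the left and right germs into one arc with `h x` in its
  -- interior; the inverse is then read off along this arc.
  have h3 : D'.IsArc (fun u => h (γ (e + u))) (t - e + r) := by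
    refine h1.concat h2 hlim (fun _ _ => rfl) (fun u _ => ?_) ?_
    · rw [← add_assoc, add_sub_cancel]
    · intro u hu u' hu' huu
      have := hγ.2.1 ⟨by linarith [he.1, hu.1], by linarith [hu.2]⟩
        ⟨by linarith [he.1, hu'.1], by linarith [hu'.2]⟩ (h.injective huu)
      linarith
  have ht' : t - e ∈ Ioo 0 (t - e + r) := ⟨h1.1, by linarith [h2.1]⟩
  have hcx : h (γ (e + (t - e))) = h (γ t) := by rw [add_sub_cancel]
  constructor
  · rw [← hcx]
    exact h3.not_isLeftEnd ht'
  · have h4 := h3.nhds_le ht'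
    simp only [add_sub_cancel] at h4
    refine (tendsto_map'_iff.2 ?_).mono_left h4
    have h5 : Tendsto (fun u => e + u) (𝓝 (t - e)) (𝓝 (e + (t - e))) :=
      tendsto_const_nhds.add tendsto_id
    rw [add_sub_cancel] at h5
    simpa [Function.comp_def] using (hγ.tendsto_nhds ht).comp h5

end IsIET

end IET

/-! ### Counting discontinuities: subadditivity, conjugacy invariance, powers -/

namespace IET

open Filter Topology Set

section Counting

variable {D D' D'' : Domain}

theorem discontinuitySet_trans_subset (h : D.Point ≃ D'.Point) (f : D'.Point ≃ D''.Point) :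
    discontinuitySet (h.trans f) ⊆ discontinuitySet h ∪ h ⁻¹' discontinuitySet f := by
  intro x hx
  by_contra hn
  simp only [mem_union, mem_preimage, not_or, discontinuitySet, mem_ofPred_eq, not_not] at hn
  exact hx (ContinuousAt.comp (g := f) hn.2 hn.1)

theorem numDisc_trans_le {h : D.Point ≃ D'.Point} {f : D'.Point ≃ D''.Point} (hh : IsIET h)
    (hf : IsIET f) : numDisc (h.trans f) ≤ numDisc h + numDisc f := by
  have hfin : (h ⁻¹' discontinuitySet f).Finite :=
    hf.finite_discontinuitySet.preimage h.injective.injOn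
  calc numDisc (h.trans f)
      ≤ (discontinuitySet h ∪ h ⁻¹' discontinuitySet f).ncard :=
        ncard_le_ncard (discontinuitySet_trans_subset h f)
          (hh.finite_discontinuitySet.union hfin)
    _ ≤ numDisc h + (h ⁻¹' discontinuitySet f).ncard := ncard_union_le _ _
    _ = numDisc h + numDisc f := by
        rw [numDisc, numDisc, ncard_preimage_of_injective_subset_range h.injective
          (by simp [h.range_eq_univ])]

theorem IsConjugate.symm {h : Equiv.Perm D.Point} {h' : Equiv.Perm D'.Point}
    (hc : IsConjugate h h') : IsConjugate h' h := by
  obtain ⟨g, hg, hgh⟩ := hc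
  exact ⟨g.symm, hg.symm, fun y => by simp [hgh]⟩

theorem IsConjugate.trans {h : Equiv.Perm D.Point} {h' : Equiv.Perm D'.Point}
    {h'' : Equiv.Perm D''.Point} (hc : IsConjugate h h') (hc' : IsConjugate h' h'') :
    IsConjugate h h'' := by
  obtain ⟨g, hg, hgh⟩ := hc
  obtain ⟨g', hg', hgh'⟩ := hc'
  exact ⟨g.trans g', hg.trans hg', fun y => by simp [hgh, hgh']⟩

theorem pow_conj_apply {h : Equiv.Perm D.Point} {h' : Equiv.Perm D'.Point}
    {g : D.Point ≃ D'.Point} (hgh : ∀ y, h' y = g (h (g.symm y))) (n : ℕ) (y : D'.Point) :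
    (h' ^ n) y = g ((h ^ n) (g.symm y)) := by
  induction n generalizing y with
  | zero => simp
  | succ n ih => rw [pow_succ, pow_succ, Equiv.Perm.mul_apply, Equiv.Perm.mul_apply, ih, hgh]; simp

theorem IsConjugate.isIET {h : Equiv.Perm D.Point} {h' : Equiv.Perm D'.Point} (hh : IsIET h)
    (hc : IsConjugate h h') : IsIET h' := by
  obtain ⟨g, hg, hgh⟩ := hc
  obtain rfl : h' = g.symm.trans (h.trans g) := Equiv.ext hgh
  exact hg.symm.trans (hh.trans hg)

/-- `h'ⁿ = g hⁿ g⁻¹`, so the outer factors cost at most `d(g⁻¹) + d(g)`, whatever `n` is. -/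
theorem IsConjugate.exists_numDisc_le {h : Equiv.Perm D.Point} {h' : Equiv.Perm D'.Point}
    (hh : IsIET h) (hc : IsConjugate h h') :
    ∃ C : ℝ, ∀ n : ℕ, (numDisc (h' ^ n) : ℝ) ≤ numDisc (h ^ n) + C := by
  obtain ⟨g, hg, hgh⟩ := hc
  refine ⟨numDisc g.symm + numDisc g, fun n => ?_⟩
  have h1 : h' ^ n = g.symm.trans ((h ^ n).trans g) := Equiv.ext (pow_conj_apply hgh n)
  have h2 := numDisc_trans_le hg.symm ((hh.pow n).trans hg)
  have h3 := numDisc_trans_le (hh.pow n) hg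
  rw [h1]
  have h4 : numDisc (g.symm.trans ((h ^ n).trans g)) ≤
      numDisc (h ^ n) + (numDisc g.symm + numDisc g) := by omega
  exact_mod_cast h4

variable {h : Equiv.Perm D.Point}

theorem IsIET.subadditive_numDisc (hh : IsIET h) :
    Subadditive fun n => (numDisc (h ^ n) : ℝ) := by
  intro m n
  beta_reduce
  rw [add_comm m n, pow_add]
  have := numDisc_trans_le (hh.pow m) (hh.pow n)
  have h2 : numDisc (h ^ n * h ^ m) ≤ numDisc (h ^ m) + numDisc (h ^ n) := this
  exact_mod_cast h2

theorem bddBelow_numDisc_div (h : Equiv.Perm D.Point) :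
    BddBelow (range fun n : ℕ => (numDisc (h ^ n) : ℝ) / n) :=
  ⟨0, by rintro _ ⟨n, rfl⟩; positivity⟩

theorem IsIET.growthRate_eq_lim (hh : IsIET h) : growthRate h = hh.subadditive_numDisc.lim := by
  unfold growthRate Subadditive.lim iInf
  congr 1
  ext r
  constructor
  · rintro ⟨n, rfl⟩
    exact ⟨n, n.2, rfl⟩
  · rintro ⟨n, hn, rfl⟩
    exact ⟨⟨n, hn⟩, rfl⟩

theorem IsIET.tendsto_growthRate (hh : IsIET h) :
    Tendsto (fun n : ℕ => (numDisc (h ^ n) : ℝ) / n) atTop (𝓝 (growthRate h)) := by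
  rw [hh.growthRate_eq_lim]
  exact hh.subadditive_numDisc.tendsto_lim (bddBelow_numDisc_div h)

theorem IsIET.mul_growthRate_le (hh : IsIET h) (n : ℕ) : n * growthRate h ≤ numDisc (h ^ n) := by
  rcases Nat.eq_zero_or_pos n with rfl | hn
  · simp
  · rw [hh.growthRate_eq_lim]
    have := hh.subadditive_numDisc.lim_le_div (bddBelow_numDisc_div h) hn.ne'
    rwa [le_div_iff₀ (by exact_mod_cast hn), mul_comm] at this

theorem growthRate_nonneg (h : Equiv.Perm D.Point) : 0 ≤ growthRate h :=
  Real.iInf_nonneg fun _ => by positivity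

theorem growthRate_eq_of_numDisc_pow (hn : ∀ n : ℕ, numDisc (h ^ n) = n * numDisc h) :
    growthRate h = numDisc h := by
  unfold growthRate
  have : ∀ n : ℕ+, (numDisc (h ^ (n : ℕ)) : ℝ) / (n : ℕ) = numDisc h := fun n => by
    rw [hn n]
    have : ((n : ℕ) : ℝ) ≠ 0 := by exact_mod_cast n.ne_zero
    push_cast
    field_simp
  simp only [this, ciInf_const]

theorem IsConjugate.growthRate_le {h' : Equiv.Perm D'.Point} (hh : IsIET h)
    (hc : IsConjugate h h') : growthRate h' ≤ growthRate h := by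
  obtain ⟨C, hC⟩ := hc.exists_numDisc_le hh
  have h1 := (hc.isIET hh).tendsto_growthRate
  have h2 := hh.tendsto_growthRate.add (tendsto_const_div_atTop_nhds_zero_nat C)
  rw [add_zero] at h2
  refine le_of_tendsto_of_tendsto' h1 h2 fun n => ?_
  rw [← add_div]
  exact div_le_div_of_nonneg_right (hC n) (Nat.cast_nonneg n)

theorem IsConjugate.growthRate_eq {h' : Equiv.Perm D'.Point} (hh : IsIET h)
    (hc : IsConjugate h h') : growthRate h = growthRate h' :=
  le_antisymm (hc.symm.growthRate_le (hc.isIET hh)) (hc.growthRate_le hh)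

/-- The sequence for `hⁿ` is `n` times the subsequence of the sequence for `h` along multiples of
`n`. -/
theorem IsIET.growthRate_pow (hh : IsIET h) {n : ℕ} (hn : 0 < n) :
    growthRate (h ^ n) = n * growthRate h := by
  have h1 := (hh.pow n).tendsto_growthRate
  have h2 : Tendsto (fun k : ℕ => n * k) atTop atTop :=
    tendsto_id.const_mul_atTop' hn
  have h3 := (hh.tendsto_growthRate.comp h2).const_mul (n : ℝ)
  refine tendsto_nhds_unique h1 (h3.congr fun k => ?_)
  have : (n : ℝ) ≠ 0 := by exact_mod_cast hn.ne'
  simp only [Function.comp_apply, Nat.cast_mul, pow_mul]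
  field_simp

theorem IsMinimalModel.growthRate_eq {Dm : Domain} {hm : Equiv.Perm Dm.Point} (hh : IsIET h)
    (H : IsMinimalModel h hm) : growthRate h = numDisc hm :=
  (H.2.1.growthRate_eq hh).trans (growthRate_eq_of_numDisc_pow H.2.2)

theorem IsVirtualMultiRotation.growthRate_eq_zero (hh : IsVirtualMultiRotation h) :
    growthRate h = 0 := by
  have h1 : numDisc h = 0 := by
    rw [numDisc, discontinuitySet]
    simp [hh.2.continuousAt]
  have h2 := hh.1.mul_growthRate_le 1
  rw [pow_one, h1] at h2
  have := growthRate_nonneg h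
  simp only [Nat.cast_one, one_mul, Nat.cast_zero] at h2
  linarith

theorem IsMinimalModel.isVirtualMultiRotation {Dm : Domain} {hm : Equiv.Perm Dm.Point}
    (hh : IsIET h) (H : IsMinimalModel h hm) (h0 : growthRate h = 0) :
    IsVirtualMultiRotation hm := by
  refine ⟨H.1, continuous_iff_continuousAt.2 fun x => ?_⟩
  rw [H.growthRate_eq hh, Nat.cast_eq_zero, numDisc,
    ncard_eq_zero H.1.finite_discontinuitySet] at h0
  by_contra hx
  have : x ∈ discontinuitySet hm := hx
  rw [h0] at this
  exact this

end Counting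

end IET

/-! ### Orbit hulls and the cutting step -/

namespace IET

open Filter Topology Set

variable {D D' : Domain}

namespace Domain.IsPartition

variable {ι : Type*} {γ : ι → ℝ → D.Point} {γ' : ι → ℝ → D'.Point} {ℓ : ι → ℝ}

theorem bijective (hp : D.IsPartition γ ℓ) :
    Function.Bijective fun x : Σ m, Ico 0 (ℓ m) => γ x.1 x.2 := by
  constructor
  · rintro ⟨m, t, ht⟩ ⟨m', t', ht'⟩ h
    obtain ⟨rfl, h2⟩ := hp.eq_of_eq ht ht' h
    obtain rfl : t = t' := h2
    rfl
  · intro x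
    obtain ⟨m, t, ht, rfl⟩ := hp.exists_eq x
    exact ⟨⟨m, t, ht⟩, rfl⟩

theorem exists_equiv (hp : D.IsPartition γ ℓ) (hp' : D'.IsPartition γ' ℓ) :
    ∃ g : D.Point ≃ D'.Point, ∀ m, ∀ t ∈ Ico 0 (ℓ m), g (γ m t) = γ' m t := by
  refine ⟨(Equiv.ofBijective _ hp.bijective).symm.trans (Equiv.ofBijective _ hp'.bijective),
    fun m t ht => ?_⟩
  have : (Equiv.ofBijective _ hp.bijective).symm (γ m t) = ⟨m, t, ht⟩ :=
    (Equiv.symm_apply_eq _).2 rfl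
  simp [this]

theorem isIET (hp : D.IsPartition γ ℓ) (hp' : D'.IsPartition γ' ℓ) [Finite ι]
    {g : D.Point ≃ D'.Point} (hg : ∀ m, ∀ t ∈ Ico 0 (ℓ m), g (γ m t) = γ' m t) : IsIET g :=
  .of_partition hp fun m => (hp'.1 m).congr (hg m)

end Domain.IsPartition

/-- The union of the orbit segments of a permutation that join two points of `T`. -/
def orbitHull {X : Type*} (h : Equiv.Perm X) (T : Set X) : Set X :=
  {y | ∃ s ∈ T, ∃ i j : ℕ, (h ^ i) s = y ∧ (h ^ j) y ∈ T}

section OrbitHull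

variable {X : Type*} {h : Equiv.Perm X} {T : Set X}

theorem subset_orbitHull : T ⊆ orbitHull h T := fun s hs => ⟨s, hs, 0, 0, rfl, hs⟩

theorem orbitHull_convex {y : X} {m n : ℕ} (hmn : m ≤ n) (hy : y ∈ orbitHull h T)
    (hn : (h ^ n) y ∈ orbitHull h T) : (h ^ m) y ∈ orbitHull h T := by
  obtain ⟨s, hs, i, -, rfl, -⟩ := hy
  obtain ⟨-, -, -, j, -, hj⟩ := hn
  refine ⟨s, hs, m + i, j + (n - m), by rw [pow_add]; rfl, ?_⟩
  rw [← Equiv.Perm.mul_apply, ← pow_add, add_assoc, Nat.sub_add_cancel hmn, pow_add]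
  exact hj

/-- Fix the two endpoints `s, s'` in `T`. If `s` is periodic, its whole orbit is finite. Otherwise
at most one `n` satisfies `hⁿ s = s'`, and the intermediate points are the `hⁱ s` with `i ≤ n`. -/
theorem finite_orbitHull (hT : T.Finite) : (orbitHull h T).Finite := by
  have hsub : orbitHull h T ⊆ ⋃ p ∈ T ×ˢ T,
      (fun i : ℕ => (h ^ i) p.1) '' {i | ∃ j : ℕ, (h ^ (i + j)) p.1 = p.2} := by
    rintro y ⟨s, hs, i, j, rfl, hj⟩
    refine mem_biUnion (x := (s, (h ^ j) ((h ^ i) s))) ⟨hs, hj⟩ ⟨i, ⟨j, ?_⟩, rfl⟩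
    rw [add_comm, pow_add]
    rfl
  refine ((hT.prod hT).biUnion ?_).subset hsub
  rintro ⟨s, s'⟩ -
  by_cases hper : ∃ p : ℕ, 0 < p ∧ (h ^ p) s = s
  · obtain ⟨p, hp, hps⟩ := hper
    refine ((Set.finite_Iio p).image fun i : ℕ => (h ^ i) s).subset ?_
    rintro _ ⟨i, -, rfl⟩
    refine ⟨i % p, Nat.mod_lt i hp, ?_⟩
    have h1 : ∀ k : ℕ, ((h ^ p) ^ k) s = s := fun k => by
      induction k with
      | zero => rfl
      | succ k ih => rw [pow_succ, Equiv.Perm.mul_apply, hps, ih]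
    change (h ^ (i % p)) s = (h ^ i) s
    conv_rhs => rw [← Nat.mod_add_div i p, pow_add, Equiv.Perm.mul_apply, pow_mul, h1]
  · refine Set.Finite.image _ ?_
    by_cases hne : ∃ n : ℕ, (h ^ n) s = s'
    · obtain ⟨n, rfl⟩ := hne
      refine (Set.finite_Iic n).subset ?_
      rintro i ⟨j, hj⟩
      by_contra hi
      have hi : n < i := not_le.1 hi
      refine hper ⟨i + j - n, by omega, (h ^ n).injective ?_⟩
      rw [← Equiv.Perm.mul_apply, ← pow_add, show n + (i + j - n) = i + j by omega]
      exact hj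
    · refine Set.finite_empty.subset ?_
      rintro i ⟨j, hj⟩
      exact hne ⟨_, hj⟩

end OrbitHull

/-- All discontinuities of `h` come from left ends, and each orbit meets the set of left ends in a
set of consecutive points. -/
structure IsCoherent (h : Equiv.Perm D.Point) : Prop where
  isIET : IsIET h
  continuousAt : ∀ y, ¬ Domain.IsLeftEnd y → ¬ Domain.IsLeftEnd (h y) → ContinuousAt h y
  convex : ∀ (y : D.Point) (m n : ℕ), m ≤ n → Domain.IsLeftEnd y → Domain.IsLeftEnd ((h ^ n) y) →
    Domain.IsLeftEnd ((h ^ m) y)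

/-- Cutting the domain at the orbit hull of the starting points of the pieces makes an interval
exchange transformation coherent. -/
theorem IsIET.exists_isCoherent {h : Equiv.Perm D.Point} (hh : IsIET h) :
    ∃ (D' : Domain) (h' : Equiv.Perm D'.Point), IsCoherent h' ∧ IsConjugate h h' := by
  obtain ⟨k₀, γ₀, ℓ₀, hp₀, hγ₀⟩ := isIET_iff.1 hh
  obtain ⟨k, m, u, ℓ, hp, hur, hst⟩ := hp₀.exists_refinement
    (finite_orbitHull (h := h) (finite_range fun m => γ₀ m 0))
    fun m => subset_orbitHull ⟨m, rfl⟩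
  have hhγ : ∀ j, D.IsArc (fun t => h (γ₀ (m j) (u j + t))) (ℓ j) := fun j =>
    (hγ₀ (m j)).sub (hur j).1 (hp.1 j).1 (hur j).2
  set G := orbitHull h (range fun m => γ₀ m 0)
  have hst' : ∀ x, x ∈ G ↔ ∃ j, (fun t => γ₀ (m j) (u j + t)) 0 = x := by simpa using hst
  generalize hγ : (fun j t => γ₀ (m j) (u j + t)) = γ at hp
  have hγ' : ∀ j t, γ₀ (m j) (u j + t) = γ j t := fun j t => congrFun (congrFun hγ j) t
  simp only [hγ'] at hhγ hst'
  clear hst hγ hγ'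
  -- Every refined piece becomes a separate segment, so the left ends of `D₁` correspond exactly to
  -- the points of the orbit hull `G`.
  let D₁ : Domain := ⟨k, fun i => .segment 0 (ℓ i) (hp.1 i).1⟩
  have hlen : (fun i => (D₁.comp i).len) = ℓ := funext fun i => sub_zero _
  have hp₁ := D₁.isPartition_param
  rw [hlen] at hp₁
  obtain ⟨g, hg⟩ := hp.exists_equiv hp₁
  have hgIET : IsIET g := hp.isIET hp₁ hg
  have hleft : ∀ i, ∀ t ∈ Ico 0 (ℓ i), (Domain.IsLeftEnd (g (γ i t)) ↔ t = 0) := by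
    intro i t ht
    rw [hg i t ht]
    constructor
    · intro hl
      by_contra h0
      exact (hp₁.1 i).not_isLeftEnd ⟨ht.1.lt_of_ne' h0, ht.2⟩ hl
    · rintro rfl
      exact Component.isLeft_param_zero (c := D₁.comp i) trivial
  have hG : ∀ x, x ∈ G ↔ Domain.IsLeftEnd (g x) := by
    intro x
    rw [hst']
    constructor
    · rintro ⟨j, rfl⟩
      exact (hleft j 0 ⟨le_rfl, (hp.1 j).1⟩).2 rfl
    · intro hl
      obtain ⟨i, t, ht, rfl⟩ := hp.exists_eq x
      rw [(hleft i t ht).1 hl]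
      exact ⟨i, rfl⟩
  have hgh : ∀ y, (g.symm.trans (h.trans g)) y = g (h (g.symm y)) := fun y => rfl
  have hconj : IsConjugate h (g.symm.trans (h.trans g)) := ⟨g, hgIET, hgh⟩
  refine ⟨D₁, g.symm.trans (h.trans g), ⟨hconj.isIET hh, fun y hy hy' => ?_,
    fun y a b hab hy hy' => ?_⟩, hconj⟩
  · obtain ⟨x, rfl⟩ := g.surjective y
    obtain ⟨i, t, ht, rfl⟩ := hp.exists_eq x
    rw [hgh, g.symm_apply_apply] at hy'
    obtain ⟨j, t', ht', hj⟩ := hp.exists_eq (h (γ i t))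
    rw [← hj, hleft j t' ht'] at hy'
    rw [hleft i t ht] at hy
    have hα : ∀ i, D₁.IsArc (fun t => g (γ i t)) (ℓ i) := fun i => (hp₁.1 i).congr (hg i)
    have h1 : t ∈ Ioo 0 (ℓ i) := ⟨ht.1.lt_of_ne' hy, ht.2⟩
    have h2 : t' ∈ Ioo 0 (ℓ j) := ⟨ht'.1.lt_of_ne' hy', ht'.2⟩
    have h3 : Tendsto (fun v => t' + (v - t)) (𝓝 t) (𝓝 t') := by
      have : Continuous fun v => t' + (v - t) := by fun_prop
      simpa using this.tendsto t
    refine (tendsto_map'_iff.2 ?_).mono_left ((hα i).nhds_le h1)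
    simp only [hgh, Function.comp_def, g.symm_apply_apply, ← hj]
    refine (((hα j).tendsto_nhds h2).comp h3).congr' ?_
    -- Near a point that is interior to its piece and has its image interior to a piece, `h` is a
    -- translation between two arcs that survive the cutting.
    filter_upwards [Ico_mem_nhds h1.1 h1.2, h3 (Ico_mem_nhds h2.1 h2.2)] with v hv hv'
    have := (hhγ i).agree (hp.1 j) (t := t) (t' := t') (u := v - t) ht ht' (by simpa using hv) hv'
      hj.symm
    simp only [add_sub_cancel] at this
    simp [this]
  · rw [pow_conj_apply hgh] at hy' ⊢
    rw [← hG] at hy' ⊢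
    rw [← g.apply_symm_apply y, ← hG] at hy
    exact orbitHull_convex hab hy hy'

end IET

/-! ### Gluing a right end to a left end -/

namespace IET

open Filter Topology Set

variable {D D' : Domain}

theorem Domain.IsArc.continuousAt_of_comp {γ : ℝ → D.Point} {ℓ t : ℝ} (hγ : D.IsArc γ ℓ)
    {h : D.Point → D'.Point} (hh : D'.IsArc (fun t => h (γ t)) ℓ) (ht : t ∈ Ioo 0 ℓ) :
    ContinuousAt h (γ t) :=
  (tendsto_map'_iff.2 (hh.tendsto_nhds ht)).mono_left (hγ.nhds_le ht)

/-- A rearrangement `g` of the components of `D` into `D'` that is the identity on circles, and that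
makes the right end of the segment `i` adjacent to the left end of the segment `j`. -/
theorem exists_glue_of_isPartition {i j : Fin D.n} (hj : (D.comp j).IsSegment)
    {p : Fin D.n → Fin D'.n} {o : Fin D.n → ℝ}
    (hp' : D'.IsPartition (fun k t => (⟨p k, (D'.comp (p k)).param (o k + t)⟩ : D'.Point))
      fun k => (D.comp k).len)
    (hk : ∀ k, k ≠ j → o k = 0 ∧ (D.comp k = D'.comp (p k) ∨
      ((D.comp k).IsSegment ∧ (D'.comp (p k)).IsSegment)))
    (hlim : Tendsto (fun t => (⟨p i, (D'.comp (p i)).param (o i + t)⟩ : D'.Point))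
      (𝓝[<] (D.comp i).len) (𝓝 ⟨p j, (D'.comp (p j)).param (o j)⟩)) :
    ∃ g : D.Point ≃ D'.Point, IsIET g ∧ Continuous g ∧
      (∀ x : D.Point, x ≠ ⟨j, (D.comp j).param 0⟩ → ContinuousAt g.symm (g x)) ∧
      Tendsto (fun t => g ⟨i, (D.comp i).param t⟩) (𝓝[<] (D.comp i).len)
        (𝓝 (g ⟨j, (D.comp j).param 0⟩)) := by
  have hp := D.isPartition_param
  obtain ⟨g, hg⟩ := hp.exists_equiv hp'
  have hgI : IsIET g := hp.isIET hp' hg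
  have hα : ∀ k, D'.IsArc (fun t => g ⟨k, (D.comp k).param t⟩) (D.comp k).len := fun k =>
    (hp'.1 k).congr (hg k)
  have hcirc : ∀ k, k ≠ j → D.comp k = D'.comp (p k) →
      ∃ φ : (D.comp k).Carrier ≃ₜ (D'.comp (p k)).Carrier, ∀ y, g ⟨k, y⟩ = ⟨p k, φ y⟩ := by
    intro k hkj hc
    obtain ⟨φ, hφ⟩ := Component.exists_homeomorph hc
    refine ⟨φ, fun y => ?_⟩
    obtain ⟨t, ht, rfl⟩ := (D.comp k).exists_param y
    have := hg k t ht
    rw [(hk k hkj).1, zero_add, ← hφ] at this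
    exact this
  refine ⟨g, hgI, continuous_iff_continuousAt.2 ?_, ?_, ?_⟩
  · rintro ⟨k, y⟩
    obtain ⟨t, ht, rfl⟩ := (D.comp k).exists_param y
    rcases ht.1.eq_or_lt with rfl | h0
    -- The base point of a circle is neither a left end nor interior to the chosen arc, so circles
    -- need a separate argument: they are carried over by homeomorphisms.
    · by_cases hs : (D.comp k).IsSegment
      · exact hgI.continuousAt_of_isLeftEnd (Component.isLeft_param_zero hs)
      · have hkj : k ≠ j := by
          rintro rfl
          exact hs hj
        rcases (hk k hkj).2 with hc | hc
        · obtain ⟨φ, hφ⟩ := hcirc k hkj hc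
          refine (Domain.isOpenEmbedding_mk k).continuousAt_iff.1 ?_
          have : Continuous fun y => (⟨p k, φ y⟩ : D'.Point) :=
            (Domain.continuous_mk (p k)).comp φ.continuous
          exact (this.congr fun y => (hφ y).symm).continuousAt
        · exact (hs hc.1).elim
    · exact (hp.1 k).continuousAt_of_comp (hα k) ⟨h0, ht.2⟩
  · rintro ⟨k, y⟩ hx
    obtain ⟨t, ht, rfl⟩ := (D.comp k).exists_param y
    rcases ht.1.eq_or_lt with rfl | h0
    · have hkj : k ≠ j := by
        rintro rfl
        exact hx rfl
      rcases (hk k hkj).2 with hc | hc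
      · obtain ⟨φ, hφ⟩ := hcirc k hkj hc
        rw [hφ]
        refine (Domain.isOpenEmbedding_mk (p k)).continuousAt_iff.1 ?_
        have : Continuous fun y => (⟨k, φ.symm y⟩ : D.Point) :=
          (Domain.continuous_mk k).comp φ.symm.continuous
        refine (this.congr fun y => ?_).continuousAt
        refine ((Equiv.symm_apply_eq g).2 ?_).symm
        rw [hφ, φ.apply_symm_apply]
      · refine hgI.symm.continuousAt_of_isLeftEnd ?_
        rw [hg k 0 ht, (hk k hkj).1, zero_add]
        exact Component.isLeft_param_zero hc.2
    · exact (hα k).continuousAt_of_comp (h := g.symm)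
        ((hp.1 k).congr fun _ _ => g.symm_apply_apply _) ⟨h0, ht.2⟩
  · rw [hg j 0 ⟨le_rfl, (D.comp j).len_pos⟩, add_zero]
    exact hlim.congr' (mem_of_superset (Ico_mem_nhdsLT (D.comp i).len_pos)
      fun t ht => (hg i t ht).symm)

theorem Component.tendsto_param (c : Component) {t : ℝ} (ht : t ∈ Ioo 0 c.len) :
    Tendsto c.param (𝓝 t) (𝓝 (c.param t)) :=
  (c.hasCoord_param ⟨ht.1.le, ht.2⟩).tendsto
    (mem_of_superset (Ico_mem_nhds ht.1 ht.2) fun _ hu => c.hasCoord_param hu)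
    (tendsto_const_nhds.add tendsto_id)

theorem Component.tendsto_param_len {c : Component} (hc : ¬ c.IsSegment) :
    Tendsto c.param (𝓝[<] c.len) (𝓝 (c.param 0)) := by
  cases c with
  | circle l hl =>
    have h1 : Tendsto (fun t : ℝ => (t : AddCircle l)) (𝓝[<] l) (𝓝 ((l : ℝ) : AddCircle l)) :=
      ((AddCircle.continuous_mk' l).tendsto l).mono_left nhdsWithin_le_nhds
    have h2 : ((l : ℝ) : AddCircle l) = ((0 : ℝ) : AddCircle l) := by
      rw [AddCircle.coe_period, AddCircle.coe_zero]
    rw [h2] at h1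
    exact h1
  | segment a b hab => exact (hc trivial).elim

/-- Gluing a segment to itself closes it into a circle of the same length. -/
theorem exists_glue_self {i : Fin D.n} (hi : (D.comp i).IsSegment) :
    ∃ (D' : Domain) (g : D.Point ≃ D'.Point), IsIET g ∧ Continuous g ∧
      (∀ x : D.Point, x ≠ ⟨i, (D.comp i).param 0⟩ → ContinuousAt g.symm (g x)) ∧
      Tendsto (fun t => g ⟨i, (D.comp i).param t⟩) (𝓝[<] (D.comp i).len)
        (𝓝 (g ⟨i, (D.comp i).param 0⟩)) := by
  let D' : Domain :=
    ⟨D.n, fun k => if k = i then .circle (D.comp i).len (D.comp i).len_pos else D.comp k⟩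
  have hci : D'.comp i = .circle (D.comp i).len (D.comp i).len_pos := if_pos rfl
  have hck : ∀ k, k ≠ i → D'.comp k = D.comp k := fun k hk => if_neg hk
  have hlen : ∀ k : Fin D.n, (D'.comp k).len = (D.comp k).len := by
    intro k
    by_cases hk : k = i
    · rw [hk, hci]
      rfl
    · rw [hck k hk]
  have hnot : ¬ (D'.comp i).IsSegment := by
    rw [hci]
    exact id
  have hlen' : (fun i => (D'.comp i).len) = fun k => (D.comp k).len := funext hlen
  have hp' := D'.isPartition_param
  rw [hlen'] at hp'
  refine ⟨D', exists_glue_of_isPartition (p := id) (o := fun _ => 0) hi ?_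
    (fun k hk => ⟨rfl, Or.inl (hck k hk).symm⟩) ?_⟩
  · have : D'.IsPartition (ι := Fin D.n) (fun k t => (⟨k, (D'.comp k).param (0 + t)⟩ : D'.Point))
        fun k => (D.comp k).len := by
      simp only [zero_add]
      exact hp'
    exact this
  · simp only [zero_add]
    have := Component.tendsto_param_len hnot
    rw [hlen i] at this
    exact ((Domain.continuous_mk (D := D') i).tendsto _).comp this

theorem exists_glue_ne {i j : Fin D.n} (hi : (D.comp i).IsSegment) (hj : (D.comp j).IsSegment)
    (hij : i ≠ j) :
    ∃ (D' : Domain) (g : D.Point ≃ D'.Point), IsIET g ∧ Continuous g ∧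
      (∀ x : D.Point, x ≠ ⟨j, (D.comp j).param 0⟩ → ContinuousAt g.symm (g x)) ∧
      Tendsto (fun t => g ⟨i, (D.comp i).param t⟩) (𝓝[<] (D.comp i).len)
        (𝓝 (g ⟨j, (D.comp j).param 0⟩)) := by
  obtain ⟨n, ⟨e⟩⟩ := Finite.exists_equiv_fin {k : Fin D.n // k ≠ j}
  have hli := (D.comp i).len_pos
  have hlj := (D.comp j).len_pos
  -- Component `j` disappears: segment `i` is lengthened by it, and `j` is placed there with offset
  -- `len i`.
  let D' : Domain := ⟨n, fun a => if (e.symm a).1 = i then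
    .segment 0 ((D.comp i).len + (D.comp j).len) (add_pos hli hlj) else D.comp (e.symm a).1⟩
  let p : Fin D.n → Fin D'.n := fun k => if hk : k = j then e ⟨i, hij⟩ else e ⟨k, hk⟩
  let o : Fin D.n → ℝ := fun k => if k = j then (D.comp i).len else 0
  have hpj : p j = e ⟨i, hij⟩ := dif_pos rfl
  have hpk : ∀ k (hk : k ≠ j), p k = e ⟨k, hk⟩ := fun k hk => dif_neg hk
  have hoj : o j = (D.comp i).len := if_pos rfl
  have hok : ∀ k, k ≠ j → o k = 0 := fun k hk => if_neg hk
  have hci : D'.comp (e ⟨i, hij⟩) =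
      .segment 0 ((D.comp i).len + (D.comp j).len) (add_pos hli hlj) :=
    if_pos (by rw [e.symm_apply_apply])
  have hck : ∀ k (hk : k ≠ j), k ≠ i → D'.comp (p k) = D.comp k := by
    intro k hk hki
    rw [hpk k hk]
    have h1 : (e.symm (e ⟨k, hk⟩)).1 = k := by rw [e.symm_apply_apply]
    exact (if_neg (by rw [h1]; exact hki)).trans (by rw [h1])
  have hleni : (D'.comp (e ⟨i, hij⟩)).len = (D.comp i).len + (D.comp j).len := by
    rw [hci]
    exact sub_zero _
  have hseg : (D'.comp (e ⟨i, hij⟩)).IsSegment := by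
    rw [hci]
    trivial
  have ho0 : ∀ k, 0 ≤ o k := by
    intro k
    by_cases hk : k = j
    · rw [hk, hoj]
      exact hli.le
    · rw [hok k hk]
  have hol : ∀ k, o k + (D.comp k).len ≤ (D'.comp (p k)).len := by
    intro k
    by_cases hk : k = j
    · rw [hk, hoj, hpj, hleni]
    · rw [hok k hk, zero_add]
      by_cases hki : k = i
      · subst hki
        rw [hpk k hk, hleni]
        linarith
      · rw [hck k hk hki]
  have hinj : ∀ k k', p k = p k' → k ≠ k' → (k = i ∧ k' = j) ∨ (k = j ∧ k' = i) := by
    intro k k' h hne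
    by_cases hk : k = j
    · by_cases hk' : k' = j
      · exact (hne (hk.trans hk'.symm)).elim
      · rw [hk, hpj, hpk k' hk'] at h
        exact Or.inr ⟨hk, (Subtype.mk.inj (e.injective h)).symm⟩
    · by_cases hk' : k' = j
      · rw [hk', hpj, hpk k hk] at h
        exact Or.inl ⟨Subtype.mk.inj (e.injective h), hk'⟩
      · rw [hpk k hk, hpk k' hk'] at h
        exact (hne (Subtype.mk.inj (e.injective h))).elim
  refine ⟨D', exists_glue_of_isPartition (p := p) (o := o) hj ⟨fun k => ?_, ?_⟩ ?_ ?_⟩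
  · exact Domain.isArc_param (p k) (D.comp k).len_pos (ho0 k) (hol k)
  · intro x
    refine existsUnique_of_exists_of_unique ?_ ?_
    · obtain ⟨a, y⟩ := x
      obtain ⟨⟨k, hk⟩, rfl⟩ := e.surjective a
      obtain ⟨s, hs, rfl⟩ := (D'.comp (e ⟨k, hk⟩)).exists_param y
      by_cases hki : k = i ∧ (D.comp i).len ≤ s
      · obtain ⟨rfl, hle⟩ := hki
        rw [hleni] at hs
        refine ⟨j, s - (D.comp k).len, ⟨by linarith, by linarith [hs.2]⟩, ?_⟩
        change (⟨p j, (D'.comp (p j)).param (o j + (s - (D.comp k).len))⟩ : D'.Point) = _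
        rw [hoj, hpj, add_sub_cancel]
      · have hlt : s < (D.comp k).len := by
          by_cases hki' : k = i
          · have := not_le.1 fun h => hki ⟨hki', h⟩
            rwa [hki']
          · rw [← hck k hk hki', hpk k hk]
            exact hs.2
        refine ⟨k, s, ⟨hs.1, hlt⟩, ?_⟩
        change (⟨p k, (D'.comp (p k)).param (o k + s)⟩ : D'.Point) = _
        rw [hok k hk, hpk k hk, zero_add]
    · rintro k k' ⟨t, ht, rfl⟩ ⟨t', ht', h⟩
      by_contra hne
      have hpp : p k' = p k := (Sigma.mk.inj h).1
      have key : ∀ a b (y : ℝ) (y' : ℝ), a = b → y ∈ Ico 0 (D'.comp a).len →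
          y' ∈ Ico 0 (D'.comp b).len → (⟨a, (D'.comp a).param y⟩ : D'.Point) =
          ⟨b, (D'.comp b).param y'⟩ → y = y' := by
        rintro a _ y y' rfl hy hy' hyy
        exact (D'.comp a).injOn_param hy hy' (eq_of_heq (Sigma.mk.inj hyy).2)
      have h3 := key _ _ _ _ hpp ⟨by linarith [ho0 k', ht'.1], by linarith [hol k', ht'.2]⟩
        ⟨by linarith [ho0 k, ht.1], by linarith [hol k, ht.2]⟩ h
      rcases hinj k k' hpp.symm hne with ⟨rfl, rfl⟩ | ⟨rfl, rfl⟩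
      · rw [hoj, hok _ hij] at h3
        linarith [ht.2, ht'.1]
      · rw [hoj, hok _ hij] at h3
        linarith [ht'.2, ht.1]
  · intro k hk
    refine ⟨hok k hk, ?_⟩
    by_cases hki : k = i
    · subst hki
      rw [hpk k hk]
      exact Or.inr ⟨hi, hseg⟩
    · exact Or.inl (hck k hk hki).symm
  · rw [hoj, hpj, hok i hij, hpk i hij]
    simp only [zero_add]
    refine ((Domain.continuous_mk (D := D') (e ⟨i, hij⟩)).tendsto _).comp
      ((Component.tendsto_param _ ⟨hli, ?_⟩).mono_left nhdsWithin_le_nhds)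
    rw [hleni]
    linarith

/-- The right end of a segment `i` can be glued to the left end of a segment `j`. -/
theorem exists_glue {i j : Fin D.n} (hi : (D.comp i).IsSegment) (hj : (D.comp j).IsSegment) :
    ∃ (D' : Domain) (g : D.Point ≃ D'.Point), IsIET g ∧ Continuous g ∧
      (∀ x : D.Point, x ≠ ⟨j, (D.comp j).param 0⟩ → ContinuousAt g.symm (g x)) ∧
      Tendsto (fun t => g ⟨i, (D.comp i).param t⟩) (𝓝[<] (D.comp i).len)
        (𝓝 (g ⟨j, (D.comp j).param 0⟩)) := by
  by_cases hij : i = j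
  · subst hij
    exact exists_glue_self hi
  · exact exists_glue_ne hi hj hij

end IET

/-! ### Coherent maps and the removal of superfluous left ends -/

namespace IET

open Filter Topology Set Domain

variable {D D' : Domain}

theorem exists_glue_arc {δ : ℝ → D.Point} {e : ℝ} (he : 0 < e) {i : Fin D.n}
    (hi : (D.comp i).IsSegment)
    (hδ : ∀ t ∈ Ico 0 e, ∃ x : (D.comp i).Carrier,
      (D.comp i).HasCoord x ((D.comp i).start + (D.comp i).len - e + t) ∧ δ t = ⟨i, x⟩)
    {q : D.Point} (hq : IsLeftEnd q) :
    ∃ (D' : Domain) (g : D.Point ≃ D'.Point), IsIET g ∧ Continuous g ∧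
      (∀ x, x ≠ q → ContinuousAt g.symm (g x)) ∧ Tendsto (fun t => g (δ t)) (𝓝[<] e) (𝓝 (g q)) := by
  obtain ⟨j, y⟩ := q
  have hy : (D.comp j).IsLeft y := hq
  obtain rfl := hy.eq_param
  obtain ⟨D', g, hg, hgc, hgs, hlim⟩ := exists_glue hi hy.isSegment
  refine ⟨D', g, hg, hgc, hgs, ?_⟩
  have hl := (D.comp i).len_pos
  have h1 : Tendsto (fun t => (D.comp i).len - e + t) (𝓝[<] e) (𝓝[<] (D.comp i).len) := by
    refine tendsto_nhdsWithin_iff.2 ⟨?_, eventually_mem_nhdsWithin.mono fun t ht => ?_⟩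
    · have : Tendsto (fun t => (D.comp i).len - e + t) (𝓝 e) (𝓝 ((D.comp i).len - e + e)) :=
        tendsto_const_nhds.add tendsto_id
      rw [sub_add_cancel] at this
      exact this.mono_left nhdsWithin_le_nhds
    · have := mem_Iio.1 ht
      exact mem_Iio.2 (by linarith)
  refine (hlim.comp h1).congr' ?_
  have hev : ∀ᶠ t in 𝓝[<] e, t ∈ Ico (max 0 (e - (D.comp i).len)) e :=
    Ico_mem_nhdsLT (max_lt he (by linarith))
  filter_upwards [hev] with t ht
  have ht0 := (le_max_left _ _).trans ht.1
  have ht1 := (le_max_right _ _).trans ht.1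
  obtain ⟨x, hx, hxt⟩ := hδ t ⟨ht0, ht.2⟩
  have h2 := (D.comp i).hasCoord_param (t := (D.comp i).len - e + t)
    ⟨by linarith, by linarith [ht.2]⟩
  rw [show (D.comp i).start + ((D.comp i).len - e + t) =
    (D.comp i).start + (D.comp i).len - e + t by ring] at h2
  rw [Function.comp_apply, hxt, hx.unique h2]

namespace IsCoherent

variable {h : Equiv.Perm D.Point}

theorem continuousAt_pow (H : IsCoherent h) (n : ℕ) {y : D.Point}
    (hy : ∀ i ≤ n, ¬ IsLeftEnd ((h ^ i) y)) : ContinuousAt (h ^ n) y := by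
  induction n with
  | zero => exact continuousAt_id
  | succ n ih =>
    have h1 := ih fun i hi => hy i (by omega)
    have h2 := H.continuousAt ((h ^ n) y) (hy n (by omega)) (by
      have := hy (n + 1) le_rfl
      rwa [pow_succ'] at this)
    have h3 := ContinuousAt.comp (g := h) h2 h1
    rw [pow_succ']
    exact h3

/-- If the image of the left germ at `y` is the left germ of a point, then `h ^ k` is not continuous
at `y`. -/
theorem false_of_tendsto (H : IsCoherent h) {y z : D.Point} (hz : ¬ IsLeftEnd z)
    (hhy : IsLeftEnd (h y)) {k : ℕ} (hk : 1 ≤ k) (hc : ContinuousAt (h ^ k) y) {F : Filter ℝ}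
    [F.NeBot] {β : ℝ → D.Point} (hβ : Tendsto β F (𝓝 y))
    (hδ : Tendsto (fun u => h (β u)) F (𝓝 z)) : False := by
  refine hz ?_
  suffices hzy : z = h y by rwa [hzy]
  -- If the forward orbit of `z` meets a left end, convexity keeps `h⁻¹ z` from being one. So `h⁻¹`
  -- is continuous at `z`, and the germ pulls back to `y = h⁻¹ z`. Otherwise `h ^ (k - 1)` is
  -- continuous at `z`, and the two limits of `h ^ k` along the germ agree.
  by_cases hfw : ∃ a : ℕ, IsLeftEnd ((h ^ a) z)
  · obtain ⟨a, ha⟩ := hfw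
    have hx : ¬ IsLeftEnd (h.symm z) := by
      intro hx
      have := H.convex (h.symm z) 1 (a + 1) (by omega) hx (by rw [pow_succ]; simpa using ha)
      exact hz (by simpa using this)
    have h1 := H.continuousAt _ hx (by simpa using hz)
    have h2 := (H.isIET.not_isLeftEnd_and_continuousAt_symm hx h1).2
    rw [h.apply_symm_apply] at h2
    have h3 := h2.tendsto.comp hδ
    simp only [Function.comp_def, h.symm_apply_apply] at h3
    rw [tendsto_nhds_unique hβ h3, h.apply_symm_apply]
  · push Not at hfw
    have h1 := (H.continuousAt_pow (k - 1) fun i _ => hfw i).tendsto.comp hδ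
    have h2 := hc.tendsto.comp hβ
    have h3 : ∀ x, (h ^ k) x = (h ^ (k - 1)) (h x) := fun x => by
      rw [← Equiv.Perm.mul_apply, ← pow_succ, Nat.sub_add_cancel hk]
    simp only [Function.comp_def, h3] at h1 h2
    exact (h ^ (k - 1)).injective (tendsto_nhds_unique h1 h2)

/-- By convexity the orbit does not return to a left end after leaving at `h (h y)`. Hence `h ^ (k -
2)` is a local homeomorphism there and can be cancelled from `h ^ k`. The case `k = 1` cannot occur.
-/
theorem continuousAt_sq (H : IsCoherent h) {y : D.Point} (hy : ¬ IsLeftEnd y)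
    (hhy : IsLeftEnd (h y)) (hhhy : ¬ IsLeftEnd (h (h y))) {k : ℕ} (hk : 1 ≤ k)
    (hc : ContinuousAt (h ^ k) y) : ContinuousAt (fun x => h (h x)) y := by
  obtain rfl | hk2 : k = 1 ∨ 2 ≤ k := by omega
  · rw [pow_one] at hc
    exact ((H.isIET.not_isLeftEnd_and_continuousAt_symm hy hc).1 hhy).elim
  obtain ⟨m, rfl⟩ := Nat.exists_eq_add_of_le' hk2
  have h0 : ∀ x, (h ^ (m + 2)) x = (h ^ m) (h (h x)) := fun x => by rw [pow_add]; rfl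
  have h1 : ContinuousAt (h ^ m) (h (h y)) := H.continuousAt_pow m fun i _ hi => by
    refine hhhy ?_
    have := H.convex (h y) 1 (i + 1) (by omega) hhy (by rw [pow_succ]; exact hi)
    simpa using this
  have h2 := ((H.isIET.pow m).not_isLeftEnd_and_continuousAt_symm hhhy h1).2
  rw [← h0] at h2
  have h3 := ContinuousAt.comp (g := (h ^ m).symm) h2 hc
  refine h3.congr (Eventually.of_forall fun x => ?_)
  rw [Function.comp_apply, h0, Equiv.symm_apply_apply]

/-- If a discontinuity point `y` of `h` is not one of `h ^ k`, then the domain can be glued at the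
left end `h y`. -/
theorem exists_glue (H : IsCoherent h) {y : D.Point} (hy : ¬ IsLeftEnd y)
    (hhy : IsLeftEnd (h y)) {k : ℕ} (hk : 1 ≤ k) (hc : ContinuousAt (h ^ k) y) :
    ∃ (D' : Domain) (h' : Equiv.Perm D'.Point), IsCoherent h' ∧ IsConjugate h h' ∧
      {x : D'.Point | IsLeftEnd x}.ncard < {x : D.Point | IsLeftEnd x}.ncard := by
  obtain ⟨γ, ℓ, t, hγ, ht, rfl⟩ := exists_isArc_of_not_isLeftEnd hy
  obtain ⟨e, he, hδ⟩ := H.isIET.exists_left_arc hγ (t := t) ⟨ht.1, ht.2.le⟩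
  have hshift : Tendsto (fun u => e + u) (𝓝[<] (t - e)) (𝓝 t) := by
    have : Tendsto (fun u => e + u) (𝓝 (t - e)) (𝓝 (e + (t - e))) :=
      tendsto_const_nhds.add tendsto_id
    rw [add_sub_cancel] at this
    exact this.mono_left nhdsWithin_le_nhds
  -- The image of the left germ at `y` cannot converge, so it runs off the right end of a segment
  -- `i`, which is the end to be glued to `h y`.
  obtain ⟨z, hz, hδz⟩ | ⟨i, hi, hδi⟩ := hδ.exists_limit_or
  · exact (H.false_of_tendsto hz hhy hk hc ((hγ.tendsto_nhds ht).comp hshift) hδz).elim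
  obtain ⟨D', g, hg, hgc, hgs, hlim⟩ := exists_glue_arc hδ.1 hi hδi hhy
  have hgh_cont : ContinuousAt (h.trans g) (γ t) := by
    refine (H.isIET.trans hg).continuousAt_of_tendsto_left hγ ht ?_
    have h1 : Tendsto (fun u => u - e) (𝓝[<] t) (𝓝[<] (t - e)) := by
      refine tendsto_nhdsWithin_iff.2 ⟨?_, eventually_mem_nhdsWithin.mono fun u hu => ?_⟩
      · exact (tendsto_id.sub_const e).mono_left nhdsWithin_le_nhds
      · exact mem_Iio.2 (sub_lt_sub_right (mem_Iio.1 hu) e)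
    have h2 := hlim.comp h1
    simp only [Function.comp_def, add_sub_cancel] at h2
    exact h2
  obtain ⟨hgq, hgq_symm⟩ := (H.isIET.trans hg).not_isLeftEnd_and_continuousAt_symm hy hgh_cont
  rw [Equiv.trans_apply] at hgq hgq_symm
  have hleft : ∀ x, IsLeftEnd (g x) ↔ IsLeftEnd x ∧ x ≠ h (γ t) := by
    refine fun x => ⟨fun hx => ⟨?_, ?_⟩, fun hx => ?_⟩
    · by_contra h1
      exact (hg.not_isLeftEnd_and_continuousAt_symm h1 hgc.continuousAt).1 hx
    · rintro rfl
      exact hgq hx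
    · by_contra h1
      refine (hg.symm.not_isLeftEnd_and_continuousAt_symm h1 (hgs x hx.2)).1 ?_
      rw [g.symm_apply_apply]
      exact hx.1
  have hgh : ∀ y, (g.symm.trans (h.trans g)) y = g (h (g.symm y)) := fun y => rfl
  have hconj : IsConjugate h (g.symm.trans (h.trans g)) := ⟨g, hg, hgh⟩
  have hne : h (γ t) ≠ γ t := fun h1 => hy (h1 ▸ hhy)
  refine ⟨D', g.symm.trans (h.trans g), ⟨hconj.isIET H.isIET, fun y' h1 h2 => ?_,
    fun y' m n hmn h1 h2 => ?_⟩, hconj, ?_⟩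
  · obtain ⟨x, rfl⟩ := g.surjective y'
    rw [hgh, g.symm_apply_apply, hleft, not_and_or, not_not] at h2
    rw [hleft, not_and_or, not_not] at h1
    by_cases hxq : x = h (γ t)
    · subst hxq
      have h3 : ¬ IsLeftEnd (h (h (γ t))) := h2.resolve_right fun h3 => hne (h.injective h3)
      -- At the glued point `g⁻¹` need not be continuous, so the new map is factored there as `g ∘
      -- h² ∘ (g ∘ h)⁻¹`, passing through `y`.
      have h4 := H.continuousAt_sq hy hhy h3 hk hc
      have h5 := ContinuousAt.comp_of_eq (g := fun x => h (h x)) h4 hgq_symm (by simp)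
      have h6 := hgc.continuousAt.comp h5
      refine h6.congr (Eventually.of_forall fun x => ?_)
      simp
    · have h3 : ContinuousAt (h.trans g) x := by
        by_cases hxt : h x = h (γ t)
        · rw [h.injective hxt]
          exact hgh_cont
        · exact hgc.continuousAt.comp
            (H.continuousAt x (h1.resolve_right hxq) (h2.resolve_right hxt))
      exact ContinuousAt.comp_of_eq (g := h.trans g) h3 (hgs x hxq) (by simp)
  · obtain ⟨x, rfl⟩ := g.surjective y'
    rw [pow_conj_apply hgh, g.symm_apply_apply, hleft] at h2 ⊢
    rw [hleft] at h1
    refine ⟨H.convex x m n hmn h1.1 h2.1, fun h3 => ?_⟩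
    -- Removing `h y` keeps runs consecutive because it is the first point of its run: a run passing
    -- through `h y` later than its start would contain `y`.
    rcases m with _ | m
    · exact h1.2 h3
    · rw [pow_succ', Equiv.Perm.mul_apply] at h3
      have := H.convex x m n (by omega) h1.1 h2.1
      rw [h.injective h3] at this
      exact hy this
  · have h1 : {x : D'.Point | IsLeftEnd x} = g '' ({x | IsLeftEnd x} \ {h (γ t)}) := by
      ext y'
      obtain ⟨x, rfl⟩ := g.surjective y'
      rw [g.injective.mem_set_image]
      exact hleft x
    rw [h1, ncard_image_of_injective _ g.injective]
    exact ncard_sdiff_singleton_lt_of_mem hhy finite_setOf_isLeftEnd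

theorem mem_discontinuitySet_iff (H : IsCoherent h) {y : D.Point} :
    y ∈ discontinuitySet h ↔ ¬ IsLeftEnd y ∧ IsLeftEnd (h y) := by
  constructor
  · intro hy
    have h1 : ¬ IsLeftEnd y := fun h1 => hy (H.isIET.continuousAt_of_isLeftEnd h1)
    exact ⟨h1, by_contra fun h2 => hy (H.continuousAt y h1 h2)⟩
  · rintro ⟨h1, h2⟩ hc
    exact (H.isIET.not_isLeftEnd_and_continuousAt_symm h1 hc).1 h2

/-- A discontinuity is followed by a left end, so an earlier left end on the orbit would force the
discontinuity itself to be one. -/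
theorem not_isLeftEnd_pow (H : IsCoherent h) {x : D.Point} {i j : ℕ} (hij : i ≤ j)
    (hx : (h ^ j) x ∈ discontinuitySet h) : ¬ IsLeftEnd ((h ^ i) x) := by
  intro hi
  rw [H.mem_discontinuitySet_iff] at hx
  refine hx.1 ?_
  have h1 : ∀ a, i ≤ a → (h ^ a) x = (h ^ (a - i)) ((h ^ i) x) := fun a ha => by
    rw [← Equiv.Perm.mul_apply, ← pow_add, Nat.sub_add_cancel ha]
  rw [h1 j hij]
  refine H.convex _ (j - i) (j + 1 - i) (by omega) hi ?_
  rw [← h1 (j + 1) (by omega), pow_succ']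
  exact hx.2

theorem numDisc_pow (H : IsCoherent h)
    (hmin : ∀ y ∈ discontinuitySet h, ∀ k : ℕ, 1 ≤ k → ¬ ContinuousAt (h ^ k) y) (n : ℕ) :
    numDisc (h ^ n) = n * numDisc h := by
  have hmem : ∀ (n : ℕ) (x : D.Point),
      x ∈ discontinuitySet (h ^ n) ↔ ∃ i < n, (h ^ i) x ∈ discontinuitySet h := by
    refine fun n x => ⟨fun hx => ?_, ?_⟩
    · by_contra hno
      push Not at hno
      refine hx ?_
      clear hx
      induction n with
      | zero => exact continuousAt_id
      | succ n ih =>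
        have h1 := not_not.1 (hno n (by omega))
        rw [pow_succ']
        exact ContinuousAt.comp (g := h) h1 (ih fun i hi => hno i (by omega))
    · rintro ⟨i, hi, hix⟩ hc
      have h1 : ∀ j ≤ i, ¬ IsLeftEnd ((h ^ j) x) := fun j hj => H.not_isLeftEnd_pow hj hix
      -- Here `h ^ i` is a local homeomorphism at `x`, so continuity of `h ^ n` at `x` would pass to
      -- `h ^ (n - i)` at the discontinuity `(h ^ i) x`, against `hmin`.
      have h2 := ((H.isIET.pow i).not_isLeftEnd_and_continuousAt_symm (h1 0 (by omega))
        (H.continuousAt_pow i h1)).2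
      refine hmin _ hix (n - i) (by omega) ?_
      have h3 := ContinuousAt.comp_of_eq (g := h ^ n) hc h2 (by simp)
      refine h3.congr (Eventually.of_forall fun z => ?_)
      rw [Function.comp_apply]
      obtain ⟨w, rfl⟩ := (h ^ i).surjective z
      rw [Equiv.symm_apply_apply, ← Equiv.Perm.mul_apply, ← pow_add, Nat.sub_add_cancel hi.le]
  induction n with
  | zero =>
    rw [zero_mul, numDisc, show discontinuitySet (h ^ 0) = ∅ from
      eq_empty_of_forall_notMem fun x hx => hx continuousAt_id, ncard_empty]
  | succ n ih =>
    have h1 : discontinuitySet (h ^ (n + 1)) =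
        discontinuitySet (h ^ n) ∪ (h ^ n) ⁻¹' discontinuitySet h := by
      ext x
      rw [mem_union, hmem, hmem, mem_preimage]
      constructor
      · rintro ⟨i, hi, hx⟩
        rcases Nat.lt_succ_iff_lt_or_eq.1 hi with h2 | rfl
        · exact Or.inl ⟨i, h2, hx⟩
        · exact Or.inr hx
      · rintro (⟨i, hi, hx⟩ | hx)
        · exact ⟨i, by omega, hx⟩
        · exact ⟨n, by omega, hx⟩
    -- An orbit enters the left ends at most once, so it contributes at most one discontinuity along
    -- distinct times.
    have h2 : Disjoint (discontinuitySet (h ^ n)) ((h ^ n) ⁻¹' discontinuitySet h) := by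
      rw [Set.disjoint_left]
      intro x hx hx'
      obtain ⟨i, hi, hxi⟩ := (hmem n x).1 hx
      refine H.not_isLeftEnd_pow (i := i + 1) (j := n) (by omega) hx' ?_
      rw [pow_succ']
      exact (H.mem_discontinuitySet_iff.1 hxi).2
    rw [numDisc, h1, ncard_union_eq h2 (H.isIET.pow n).finite_discontinuitySet
      (H.isIET.finite_discontinuitySet.preimage (h ^ n).injective.injOn), add_mul, one_mul, ← ih,
      ncard_preimage_of_injective_subset_range (h ^ n).injective
        (by simp [(h ^ n).range_eq_univ])]
    rfl

end IsCoherent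

/-- Among the coherent conjugates, take one with the fewest left ends; a repairable discontinuity
would allow one more gluing. -/
theorem IsIET.exists_isMinimalModel {h : Equiv.Perm D.Point} (hh : IsIET h) :
    ∃ (Dm : Domain) (hm : Equiv.Perm Dm.Point), IsMinimalModel h hm := by
  classical
  have hex : ∃ (n : ℕ) (D' : Domain) (h' : Equiv.Perm D'.Point), IsCoherent h' ∧
      IsConjugate h h' ∧ {x : D'.Point | IsLeftEnd x}.ncard = n := by
    obtain ⟨D', h', H, hc⟩ := hh.exists_isCoherent
    exact ⟨_, D', h', H, hc, rfl⟩
  obtain ⟨Dm, hm, H, hc, hcard⟩ := Nat.find_spec hex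
  refine ⟨Dm, hm, H.isIET, hc, H.numDisc_pow fun y hy k hk hcont => ?_⟩
  rw [H.mem_discontinuitySet_iff] at hy
  obtain ⟨D', h', H', hc', hlt⟩ := H.exists_glue hy.1 hy.2 hk hcont
  rw [hcard] at hlt
  exact Nat.find_min hex hlt ⟨D', h', H', hc.trans hc', rfl⟩

end IET

/-! ### The main theorem -/

theorem mainTheorem7 (D : IET.Domain) (h : Equiv.Perm D.Point) (hh : IET.IsIET h) :
    -- the infimum defining the growth rate is a limit
    Filter.Tendsto (fun n : ℕ => (IET.numDisc (h ^ n) : ℝ) / n) Filter.atTop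
      (nhds (IET.growthRate h)) ∧
    -- minimal models exist
    (∃ (Dm : IET.Domain) (hm : Equiv.Perm Dm.Point), IET.IsMinimalModel h hm) ∧
    -- they compute the growth rate and minimize the number of discontinuities among conjugates
    (∀ (Dm : IET.Domain) (hm : Equiv.Perm Dm.Point), IET.IsMinimalModel h hm →
      IET.growthRate h = IET.growthRate hm ∧
      IET.growthRate hm = (IET.numDisc hm : ℝ) ∧
      ∀ (D' : IET.Domain) (h' : Equiv.Perm D'.Point), IET.IsIET h' → IET.IsConjugate h h' →
        ∀ n : ℕ, IET.numDisc (hm ^ n) ≤ IET.numDisc (h' ^ n)) ∧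
    (∃ N : ℕ, IET.growthRate h = (N : ℝ)) ∧
    (∃ C : ℝ, ∀ n : ℕ, (n : ℝ) * IET.growthRate h - C ≤ (IET.numDisc (h ^ n) : ℝ) ∧
      (IET.numDisc (h ^ n) : ℝ) ≤ (n : ℝ) * IET.growthRate h + C) ∧
    (IET.growthRate h = 0 ↔
      ∃ (D' : IET.Domain) (r : Equiv.Perm D'.Point),
        IET.IsVirtualMultiRotation r ∧ IET.IsConjugate h r) ∧
    (IET.IsDivisible h → IET.growthRate h = 0) ∧
    ((∀ N : ℕ, ∃ n : ℕ, N ≤ n ∧ IET.HasRoot h n) → IET.growthRate h = 0) := by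
  have hroot : (∀ N : ℕ, ∃ n : ℕ, N ≤ n ∧ IET.HasRoot h n) → IET.growthRate h = 0 := by
    intro hr
    obtain ⟨N, hN⟩ := exists_nat_gt (IET.growthRate h)
    -- With `‖h‖ = n‖g‖ < N < n` and `‖g‖` a natural number, `‖g‖` must be `0`.
    obtain ⟨n, hn, g, hg, rfl⟩ := hr (N + 1)
    have hn0 : 0 < n := by omega
    rw [hg.growthRate_pow hn0] at hN ⊢
    obtain ⟨Dm, gm, hgm⟩ := hg.exists_isMinimalModel
    rw [hgm.growthRate_eq hg] at hN ⊢
    have h1 : n * IET.numDisc gm < N := by exact_mod_cast hN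
    have h2 : IET.numDisc gm = 0 := by
      by_contra h3
      have := Nat.mul_le_mul_left n (Nat.one_le_iff_ne_zero.2 h3)
      omega
    rw [h2]
    simp
  obtain ⟨Dm, hm, H⟩ := hh.exists_isMinimalModel
  refine ⟨hh.tendsto_growthRate, ⟨Dm, hm, H⟩, ?_, ⟨_, H.growthRate_eq hh⟩, ?_, ⟨fun h0 => ?_, ?_⟩,
    fun hd => hroot fun N => ⟨N + 1, by omega, hd _ (by omega)⟩, hroot⟩
  · intro Dm hm H
    refine ⟨H.2.1.growthRate_eq hh, IET.growthRate_eq_of_numDisc_pow H.2.2,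
      fun D' h' hh' hc n => ?_⟩
    have h1 := hh'.mul_growthRate_le n
    rw [← hc.growthRate_eq hh, H.growthRate_eq hh] at h1
    rw [H.2.2 n]
    exact_mod_cast h1
  · obtain ⟨C, hC⟩ := H.2.1.symm.exists_numDisc_le H.1
    -- The lower bound holds without a constant, so the constant only has to be nonnegative there.
    refine ⟨max C 0, fun n => ⟨?_, ?_⟩⟩
    · have := hh.mul_growthRate_le n
      linarith [le_max_right C 0]
    · have := hC n
      rw [H.2.2 n, Nat.cast_mul, ← H.growthRate_eq hh] at this
      linarith [le_max_left C 0]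
  · exact ⟨Dm, hm, H.isVirtualMultiRotation hh h0, H.2.1⟩
  · rintro ⟨D', r, hr, hc⟩
    rw [hc.growthRate_eq hh, hr.growthRate_eq_zero]
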